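/- Let $f$ be a rational function of degree $d\ge 2$, regarded as a holomorphic self-map of the Riemann sphere $\overline{\mathbb C}=\mathbb C\cup\{\infty\}$. For a holomorphic map $g:\overline{\mathbb C}\to\overline{\mathbb C}$ let $$\|g'(z)\|=\frac{|g'(z)|\,(1+|z|^2)}{1+|g(z)|^2}$$ be the norm of its derivative with respect to the spherical metric $|dz|/(1+|z|^2)$ (computed in the coordinate $1/z$ where $z$ or $g(z)$ is $\infty$), and let $K(g)=\sup_{z\in\overline{\mathbb C}}\|g'(z)\|$. Write $f^n$ for the $n$-th iterate of $f$. Then each supremum $K(f^n)$ is attained, the limit $$k_\infty(f)=\lim_{n\to\infty}\frac1n\log K(f^n)$$ exists in $\mathbb R$, and, with $M=\{z\in\overline{\mathbb C}:\|f'(z)\|=K(f)\}$, one has $$k_\infty(f)=\log K(f)$$ if and only if $M$ contains a cycle of $f$, that is, if and only if there is a periodic point of $f$ whose whole orbit under $f$ lies in $M$. -/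

import Mathlib

open Filter Topology

noncomputable section

namespace SphericalDynamics

/-- The Riemann sphere. -/
abbrev Sphere : Type := OnePoint ℂ

/-- The inversion `z ↦ 1 / z` of the sphere, exchanging `0` and `∞`. -/
def inversion (z : Sphere) : Sphere :=
  z.elim ((0 : ℂ) : Sphere) (fun w : ℂ => if w = 0 then OnePoint.infty else ((w⁻¹ : ℂ) : Sphere))

/-- The affine coordinate of a finite point (with the dummy value `0` at `∞`). -/
def coord (z : Sphere) : ℂ := z.elim 0 id

/-- The coordinate change used near `z`: nothing at finite points, the inversion at `∞`. -/
def flipAt (z : Sphere) : Sphere → Sphere :=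
  z.elim inversion (fun _ => id)

/-- The expression `|f'(z)| (1 + |z|²) / (1 + |f(z)|²)`, meant for a finite point `z` with finite
image `f(z)`. -/
def affineSphDeriv (F : Sphere → Sphere) (z : ℂ) : ℝ :=
  ‖deriv (fun w : ℂ => coord (F (w : Sphere))) z‖ * (1 + ‖z‖ ^ 2) /
    (1 + ‖coord (F (z : Sphere))‖ ^ 2)

/-- The norm `‖F'‖(z)` of the derivative of a self-map of the sphere with respect to the spherical
metric `|dz| / (1 + |z|²)`. If `z` or `F z` is `∞`, it is computed in the coordinate `1 / z` there;
this is legitimate because the inversion is an isometry of the spherical metric. -/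
def sphDeriv (F : Sphere → Sphere) (z : Sphere) : ℝ :=
  affineSphDeriv (flipAt (F z) ∘ F ∘ flipAt z) (coord (flipAt z z))

/-- At a finite point with finite image, `sphDeriv` is given by the usual formula. -/
theorem sphDeriv_coe (F : Sphere → Sphere) (z v : ℂ) (h : F (z : Sphere) = (v : Sphere)) :
    sphDeriv F (z : Sphere) =
      ‖deriv (fun w : ℂ => coord (F (w : Sphere))) z‖ * (1 + ‖z‖ ^ 2) / (1 + ‖v‖ ^ 2) := by
  simp [sphDeriv, affineSphDeriv, flipAt, h, coord]

/-- `K(F)`, the supremum over the sphere of the norm of the derivative. -/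
def supDeriv (F : Sphere → Sphere) : ℝ := sSup (Set.range (sphDeriv F))

/-- The set `M` of the points where the norm of the derivative equals `K(F)`. -/
def maxSet (F : Sphere → Sphere) : Set Sphere := {z | sphDeriv F z = supDeriv F}

/-- `k_∞(F) = lim (1 / n) log K(F^n)`, where `F^n` is the `n`-th iterate. -/
def kInfty (F : Sphere → Sphere) : ℝ :=
  limUnder atTop (fun n : ℕ => 1 / (n : ℝ) * Real.log (supDeriv F^[n]))

/-- The degree of a rational function: the larger one of the degrees of numerator and denominator
in lowest terms. -/
def ratDegree (f : RatFunc ℂ) : ℕ := max f.num.natDegree f.denom.natDegree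

/-- The self-map of the Riemann sphere that a rational function induces. With `f = p / q` in
lowest terms and `d` the degree of `f`, its value at `∞` is the quotient of the coefficients of
`z ^ d` in `p` and `q` (which do not both vanish). -/
def toSphereMap (f : RatFunc ℂ) (z : Sphere) : Sphere :=
  z.elim
    (if f.denom.coeff (ratDegree f) = 0 then OnePoint.infty
      else ((f.num.coeff (ratDegree f) / f.denom.coeff (ratDegree f) : ℂ) : Sphere))
    (fun w : ℂ => if f.denom.eval w = 0 then OnePoint.infty
      else ((f.num.eval w / f.denom.eval w : ℂ) : Sphere))

end SphericalDynamics

end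

/-! By the chain rule `log K(f^n)` is subadditive, and it is nonnegative, so Fekete's lemma gives
the limit and identifies it with the infimum of `(1/n) log K(f^n)`. If the limit is `log K(f)`, then
`K(f^n) = K(f)^n` for all `n`. A point of maximal expansion for `f^n` then has its first `n`
iterates in `M`, and compactness yields a point whose whole orbit lies in `M`. Conversely, such an
orbit clearly forces `K(f^n) = K(f)^n`. What remains is to find a periodic point in the closed set
`E` of all points whose orbit stays in `M` (`maxOrbitSet`), once `E` is nonempty.

If `E` is finite, the pigeonhole principle suffices. If `E` is infinite, its derived set `E'` is
compact, nonempty and forward invariant, and near it `f` has local inverses with derivative norm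
close to `1/K(f)`. Here `K(f) > 1`: otherwise a maximum principle (`sphNorm_eventually_eq`) would
make the norm of the derivative constant, though it vanishes at critical points and not elsewhere
(`Hol.one_lt_supDeriv`).

The crux is that these local inverses map `E'` to `E'` (`exists_local_inverse`). On `M` the gradient
of the norm of the derivative vanishes. With `conj z` treated as an independent variable, this
equation can be solved holomorphically for `conj z` because `K(f) ≠ 1`
(`exists_analyticAt_eq_conj`). So on `M`, locally, a real-analytic condition becomes the vanishing
of a holomorphic function, and if it holds at points accumulating somewhere, it holds at all nearby
points of `M` (`sphNorm_eq_of_frequently`). This is applied to the condition that the local inverse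
has derivative norm `1/K(f)`.

Consequently points of `E'` close to an image point lift, with contraction, to points of `E'`. In a
compact set this forces a periodic point: some return displacement is small, and a minimal one that
is nonzero could be decreased by lifting (`exists_mem_periodicPts_of_lift`). -/

open scoped ComplexConjugate

noncomputable section

namespace SphericalDynamics

/-! ### The spherical derivative in an affine coordinate -/

/-- The norm of the derivative of a function of a complex variable with respect to the spherical
metric. -/
def sphNorm (g : ℂ → ℂ) (a : ℂ) : ℝ := ‖deriv g a‖ * (1 + ‖a‖ ^ 2) / (1 + ‖g a‖ ^ 2)

theorem one_add_norm_sq_pos (a : ℂ) : 0 < 1 + ‖a‖ ^ 2 := by positivity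

theorem one_add_norm_sq_ne_zero (a : ℂ) : 1 + ‖a‖ ^ 2 ≠ 0 := by positivity

theorem sphNorm_nonneg (g : ℂ → ℂ) (a : ℂ) : 0 ≤ sphNorm g a := by unfold sphNorm; positivity

theorem sphNorm_eq_zero_iff {g : ℂ → ℂ} {a : ℂ} : sphNorm g a = 0 ↔ deriv g a = 0 := by
  simp [sphNorm, one_add_norm_sq_ne_zero]

theorem sphNorm_congr {g h : ℂ → ℂ} {a : ℂ} (H : g =ᶠ[𝓝 a] h) : sphNorm g a = sphNorm h a := by
  simp only [sphNorm, H.deriv_eq, H.eq_of_nhds]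

theorem sphNorm_id (a : ℂ) : sphNorm id a = 1 := by
  simp [sphNorm, div_self (one_add_norm_sq_ne_zero a)]

theorem sphNorm_comp {g h : ℂ → ℂ} {a : ℂ} (hh : DifferentiableAt ℂ h (g a))
    (hg : DifferentiableAt ℂ g a) : sphNorm (h ∘ g) a = sphNorm h (g a) * sphNorm g a := by
  have := one_add_norm_sq_ne_zero (g a)
  simp only [sphNorm, deriv_comp a hh hg, norm_mul, Function.comp_apply]
  field_simp

theorem continuousAt_sphNorm {g : ℂ → ℂ} {a : ℂ} (hg : AnalyticAt ℂ g a) :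
    ContinuousAt (sphNorm g) a := by
  unfold sphNorm
  have h1 := hg.deriv.continuousAt
  have h2 := hg.continuousAt
  exact ContinuousAt.div (by fun_prop) (by fun_prop) (one_add_norm_sq_ne_zero _)

theorem sphNorm_inv {a : ℂ} (ha : a ≠ 0) : sphNorm (fun z => z⁻¹) a = 1 := by
  have h : ‖a‖ ≠ 0 := norm_ne_zero_iff.mpr ha
  have := one_add_norm_sq_ne_zero a
  simp only [sphNorm, deriv_inv, norm_neg, norm_inv, norm_pow]
  field_simp
  ring

/-! ### Rotations of the sphere -/

/-- The rotation of the sphere that takes `0` to `b`, in the affine coordinate. -/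
def rotation (b z : ℂ) : ℂ := (z + b) / (1 - conj b * z)

theorem rotation_zero (b : ℂ) : rotation b 0 = b := by simp [rotation]

theorem rotation_neg_self (b : ℂ) : rotation (-b) b = 0 := by simp [rotation]

theorem one_add_conj_mul_self_ne_zero (b : ℂ) : 1 + conj b * b ≠ 0 := by
  rw [Complex.conj_mul']
  exact_mod_cast one_add_norm_sq_ne_zero b

theorem rotation_neg_rotation {b z : ℂ} (hz : 1 - conj b * z ≠ 0) :
    rotation (-b) (rotation b z) = z := by
  have h := one_add_conj_mul_self_ne_zero b
  rw [rotation, rotation, map_neg]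
  generalize conj b = c at hz h
  have h2 : 1 - -c * ((z + b) / (1 - c * z)) = (1 + c * b) / (1 - c * z) := by
    rw [eq_div_iff hz, sub_mul, mul_assoc, div_mul_cancel₀ _ hz]
    ring
  rw [h2, div_div_eq_mul_div, div_add' _ _ _ hz, div_mul_cancel₀ _ hz, div_eq_iff h]
  ring

theorem hasDerivAt_rotation {b z : ℂ} (hz : 1 - conj b * z ≠ 0) :
    HasDerivAt (rotation b) ((1 + conj b * b) / (1 - conj b * z) ^ 2) z := by
  have h1 : HasDerivAt (fun z : ℂ => z + b) 1 z := (hasDerivAt_id z).add_const b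
  have h2 : HasDerivAt (fun z : ℂ => 1 - conj b * z) (-(conj b * 1)) z :=
    ((hasDerivAt_id z).const_mul (conj b)).const_sub 1
  refine (h1.div h2 hz).congr_deriv ?_
  congr 1
  ring

theorem analyticAt_rotation {b z : ℂ} (hz : 1 - conj b * z ≠ 0) : AnalyticAt ℂ (rotation b) z := by
  unfold rotation
  exact AnalyticAt.fun_div (by fun_prop) (by fun_prop) hz

/-- The matrix of numerator and denominator of the rotation is unitary up to the factor `√(1 + ‖b‖ ^
2)`. This is why rotations are isometries of the spherical metric. -/
theorem norm_sq_add_norm_sq_rotation (b z : ℂ) :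
    ‖1 - conj b * z‖ ^ 2 + ‖z + b‖ ^ 2 = (1 + ‖b‖ ^ 2) * (1 + ‖z‖ ^ 2) := by
  simp only [← Complex.normSq_eq_norm_sq, Complex.normSq_apply]
  simp
  ring

theorem sphNorm_rotation {b z : ℂ} (hz : 1 - conj b * z ≠ 0) : sphNorm (rotation b) z = 1 := by
  have h0 : ‖1 - conj b * z‖ ≠ 0 := norm_ne_zero_iff.mpr hz
  have h1 := norm_sq_add_norm_sq_rotation b z
  have h2 : ‖1 + conj b * b‖ = 1 + ‖b‖ ^ 2 := by
    rw [Complex.conj_mul', ← Complex.ofReal_pow, ← Complex.ofReal_one, ← Complex.ofReal_add,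
      Complex.norm_real, Real.norm_of_nonneg (one_add_norm_sq_pos b).le]
  have h3 : 1 + ‖rotation b z‖ ^ 2 = (1 + ‖b‖ ^ 2) * (1 + ‖z‖ ^ 2) / ‖1 - conj b * z‖ ^ 2 := by
    rw [← h1, rotation, norm_div, add_div, div_self (pow_ne_zero 2 h0), div_pow]
  rw [sphNorm, (hasDerivAt_rotation hz).deriv, h3, norm_div, h2, norm_pow]
  have := one_add_norm_sq_ne_zero b
  have := one_add_norm_sq_ne_zero z
  field_simp

/-! ### The maximum principle for spherical contractions -/

/-- A holomorphic map that fixes `0` and does not expand the spherical metric does not increase the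
distance to `0`. -/
theorem norm_le_of_sphNorm_le_one {G : ℂ → ℂ} (hG : AnalyticAt ℂ G 0) (h0 : G 0 = 0)
    (hle : ∀ᶠ z in 𝓝 0, sphNorm G z ≤ 1) : ∀ᶠ z in 𝓝 0, ‖G z‖ ≤ ‖z‖ := by
  obtain ⟨r, hr, hball⟩ := Metric.eventually_nhds_iff_ball.1 (hle.and hG.eventually_analyticAt)
  filter_upwards [Metric.ball_mem_nhds (0 : ℂ) hr, Metric.ball_mem_nhds (0 : ℂ) one_half_pos]
    with z hz hz2
  rw [mem_ball_zero_iff] at hz hz2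
  -- The slack `ε` provides the strict inequality that the comparison lemma along the segment from
  -- `0` to `z` demands.
  have key : ∀ ε : ℝ, 0 < ε → ε ≤ 1 → ‖G z‖ ≤ (1 + ε) * ‖z‖ := by
    intro ε hε hε1
    by_cases hz0 : z = 0
    · simp [hz0, h0]
    have hzn : 0 < ‖z‖ := norm_pos_iff.mpr hz0
    have hmem : ∀ t ∈ Set.Icc (0 : ℝ) 1, (t : ℂ) * z ∈ Metric.ball (0 : ℂ) r := by
      intro t ht
      rw [mem_ball_zero_iff, norm_mul, Complex.norm_real, Real.norm_of_nonneg ht.1]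
      nlinarith [ht.1, ht.2]
    have hder : ∀ t ∈ Set.Icc (0 : ℝ) 1,
        HasDerivAt (fun t : ℝ => G (t * z)) (deriv G (t * z) * z) t := by
      intro t ht
      have h1 : HasDerivAt (fun s : ℂ => s * z) z (t : ℂ) := by
        simpa using (hasDerivAt_id (t : ℂ)).mul_const z
      exact HasDerivAt.comp_ofReal
        (HasDerivAt.comp (t : ℂ) (hball _ (hmem t ht)).2.differentiableAt.hasDerivAt h1)
    have := image_norm_le_of_norm_deriv_right_lt_deriv_boundary
      (f := fun t : ℝ => G (t * z)) (a := 0) (b := 1) (B := fun t => (1 + ε) * ‖z‖ * t)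
      (B' := fun _ => (1 + ε) * ‖z‖) (f' := fun t => deriv G (t * z) * z)
      (fun t ht => (hder t ht).continuousAt.continuousWithinAt)
      (fun t ht => (hder t (Set.Ico_subset_Icc_self ht)).hasDerivWithinAt)
      (by simp [h0]) (fun t => by simpa using (hasDerivAt_id t).const_mul ((1 + ε) * ‖z‖))
      (fun t ht hn => ?_) (Set.right_mem_Icc.mpr zero_le_one)
    · simpa using this
    -- At a contact point with the barrier, `‖deriv G‖ ≥ 1 + ε` would give `1 ≤ (1 + ε) * s ^ 2`,
    -- which is impossible for `ε ≤ 1` and `s < 1 / 2`.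
    · have h1 := (hball _ (hmem t (Set.Ico_subset_Icc_self ht))).1
      rw [sphNorm, div_le_one (one_add_norm_sq_pos _), hn, norm_mul, Complex.norm_real,
        Real.norm_of_nonneg ht.1] at h1
      rw [norm_mul]
      refine mul_lt_mul_of_pos_right ?_ hzn
      set s := t * ‖z‖ with hs
      have hs0 : 0 ≤ s := mul_nonneg ht.1 hzn.le
      have hs1 : s < 1 / 2 := by nlinarith [ht.1, ht.2]
      have h2 : (1 + ε) * ‖z‖ * t = (1 + ε) * s := by rw [hs]; ring
      rw [h2] at h1
      by_contra hcon
      push Not at hcon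
      have h3 : (1 + ε) * (1 + s ^ 2) ≤ 1 + ((1 + ε) * s) ^ 2 :=
        (mul_le_mul_of_nonneg_right hcon (by positivity)).trans h1
      have h4 : s ^ 2 ≤ 1 / 4 := by nlinarith
      nlinarith [mul_nonneg hε.le (sub_nonneg.mpr h4), mul_nonneg (mul_nonneg hε.le hε.le) (sub_nonneg.mpr h4)]
  have hlim : Tendsto (fun ε : ℝ => (1 + ε) * ‖z‖) (𝓝[>] 0) (𝓝 ((1 + 0) * ‖z‖)) :=
    ((continuous_const.add continuous_id).mul continuous_const).continuousAt.tendsto.mono_left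
      nhdsWithin_le_nhds
  rw [add_zero, one_mul] at hlim
  refine ge_of_tendsto hlim ?_
  filter_upwards [Ioc_mem_nhdsGT (zero_lt_one (α := ℝ))] with ε hε using key ε hε.1 hε.2

/-- Since `‖G z‖ ≤ ‖z‖`, the metric factor `(1 + ‖z‖ ^ 2) / (1 + ‖G z‖ ^ 2)` is at least `1`, with
equality at `0`. So `‖deriv G‖` also has a local maximum at `0` and is constant by the maximum
modulus principle; the metric factor then bounds `sphNorm G` from below by its value at `0`. -/
theorem sphNorm_eventually_eq_of_map_zero {G : ℂ → ℂ} (hG : AnalyticAt ℂ G 0) (h0 : G 0 = 0)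
    (hmax : ∀ᶠ z in 𝓝 0, sphNorm G z ≤ sphNorm G 0) (h1 : sphNorm G 0 ≤ 1) :
    ∀ᶠ z in 𝓝 0, sphNorm G z = sphNorm G 0 := by
  have hle := norm_le_of_sphNorm_le_one hG h0 (hmax.mono fun z hz => hz.trans h1)
  have hd0 : sphNorm G 0 = ‖deriv G 0‖ := by simp [sphNorm, h0]
  have hfrac : ∀ z, ‖G z‖ ≤ ‖z‖ → 1 + ‖G z‖ ^ 2 ≤ 1 + ‖z‖ ^ 2 := fun z hz => by gcongr
  have hloc : IsLocalMax (norm ∘ deriv G) 0 := by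
    filter_upwards [hle, hmax] with z hz hzm
    rw [hd0, sphNorm, div_le_iff₀ (one_add_norm_sq_pos _)] at hzm
    have h2 := hfrac z hz
    have h3 := norm_nonneg (deriv G 0)
    have : ‖deriv G z‖ * (1 + ‖z‖ ^ 2) ≤ ‖deriv G 0‖ * (1 + ‖z‖ ^ 2) :=
      hzm.trans (mul_le_mul_of_nonneg_left h2 h3)
    exact le_of_mul_le_mul_right this (one_add_norm_sq_pos z)
  have hconst := Complex.eventually_eq_of_isLocalMax_norm
    (hG.deriv.eventually_analyticAt.mono fun z hz => hz.differentiableAt) hloc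
  filter_upwards [hle, hmax, hconst] with z hz hzm hzc
  refine le_antisymm hzm ?_
  rw [hd0, sphNorm, hzc, le_div_iff₀ (one_add_norm_sq_pos _)]
  exact mul_le_mul_of_nonneg_left (hfrac z hz) (norm_nonneg _)

/-- If the spherical norm of the derivative has a local maximum with value at most `1`, then it is
locally constant. -/
theorem sphNorm_eventually_eq {g : ℂ → ℂ} {b : ℂ} (hg : AnalyticAt ℂ g b)
    (hmax : ∀ᶠ z in 𝓝 b, sphNorm g z ≤ sphNorm g b) (h1 : sphNorm g b ≤ 1) :
    ∀ᶠ z in 𝓝 b, sphNorm g z = sphNorm g b := by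
  have hden0 : 1 - conj b * 0 ≠ 0 := by simp
  have hb0 := rotation_zero b
  have hrot := analyticAt_rotation hden0
  have hden1 : 1 - conj (-g b) * g b ≠ 0 := by
    simpa using one_add_conj_mul_self_ne_zero (g b)
  have hrot2 := analyticAt_rotation hden1
  -- Rotations on both sides move `b` and `g b` to `0` without changing the spherical norm.
  set G : ℂ → ℂ := rotation (-g b) ∘ g ∘ rotation b with hGdef
  have hgb : AnalyticAt ℂ (g ∘ rotation b) 0 := AnalyticAt.comp (by rwa [hb0]) hrot
  have hG : AnalyticAt ℂ G 0 := by
    refine AnalyticAt.comp ?_ hgb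
    rwa [Function.comp_apply, hb0]
  have hG0 : G 0 = 0 := by simp only [hGdef, Function.comp_apply, hb0, rotation_neg_self]
  have hcont : Tendsto (rotation b) (𝓝 0) (𝓝 b) := by
    simpa only [hb0] using hrot.continuousAt.tendsto
  have hcont2 : Tendsto (rotation (-b)) (𝓝 b) (𝓝 0) := by
    have : 1 - conj (-b) * b ≠ 0 := by simpa using one_add_conj_mul_self_ne_zero b
    simpa only [rotation_neg_self] using (analyticAt_rotation this).continuousAt.tendsto
  have hGg : ∀ᶠ z in 𝓝 0, sphNorm G z = sphNorm g (rotation b z) := by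
    have e1 : ∀ᶠ z in 𝓝 (0 : ℂ), 1 - conj b * z ≠ 0 :=
      ContinuousAt.eventually_ne (by fun_prop) hden0
    have e2 : ∀ᶠ w in 𝓝 (g b), 1 - conj (-g b) * w ≠ 0 :=
      ContinuousAt.eventually_ne (by fun_prop) hden1
    filter_upwards [e1, hcont.eventually (hg.continuousAt.tendsto.eventually e2),
      hcont.eventually hg.eventually_analyticAt] with z hz1 hz2 hz3
    have d1 := (analyticAt_rotation hz1).differentiableAt
    have d2 := (analyticAt_rotation hz2).differentiableAt
    rw [hGdef, sphNorm_comp (g := g ∘ rotation b) d2 (hz3.differentiableAt.comp z d1),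
      sphNorm_comp hz3.differentiableAt d1, sphNorm_rotation hz1, Function.comp_apply,
      sphNorm_rotation hz2]
    ring
  have hG1 : sphNorm G 0 = sphNorm g b := by rw [hGg.self_of_nhds, hb0]
  have main := sphNorm_eventually_eq_of_map_zero hG hG0
    (by filter_upwards [hGg, hcont.eventually hmax] with z hz hz2; rwa [hz, hG1])
    (hG1.trans_le h1)
  have e3 : ∀ᶠ z in 𝓝 b, 1 - conj (-b) * z ≠ 0 :=
    ContinuousAt.eventually_ne (by fun_prop) (by simpa using one_add_conj_mul_self_ne_zero b)
  filter_upwards [hcont2.eventually (main.and hGg), e3] with z hz hz3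
  have := rotation_neg_rotation hz3
  rw [neg_neg] at this
  rw [← hG1, ← hz.1, hz.2, this]

/-! ### Points of maximal expansion lie on an analytic arc -/

/-- The function whose zero set is given by the vanishing of the gradient of `sphNorm F`, with
the conjugates of `z` and of `F z` replaced by `w` and by `conj (F (conj w))`. -/
def polarGradient (F : ℂ → ℂ) (v : ℂ × ℂ) : ℂ :=
  (1 + F v.1 * conj (F (conj v.2))) *
      (deriv (deriv F) v.1 * (1 + v.1 * v.2) + 2 * deriv F v.1 * v.2) -
    2 * deriv F v.1 ^ 2 * conj (F (conj v.2)) * (1 + v.1 * v.2)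

theorem hasDerivAt_comp_line {F : ℂ → ℂ} {y F' : ℂ} (hF : HasDerivAt F F' y) (h : ℂ) :
    HasDerivAt (fun t : ℝ => F (y + t * h)) (F' * h) 0 := by
  have h1 : HasDerivAt (fun s : ℂ => y + s * h) h ((0 : ℝ) : ℂ) := by
    simpa using ((hasDerivAt_id ((0 : ℝ) : ℂ)).mul_const h).const_add y
  have h2 : HasDerivAt F F' (y + ((0 : ℝ) : ℂ) * h) := by simpa using hF
  exact HasDerivAt.comp_ofReal (HasDerivAt.comp ((0 : ℝ) : ℂ) h2 h1)

/-- The function `N` below has a local maximum at `y`, so its Wirtinger derivative `A` vanishes.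
Eliminating `K ^ 2` by means of `N y = 0` leaves `polarGradient` times the nonzero factor `conj
(deriv F y) * (1 + y * conj y)`. -/
theorem polarGradient_eq_zero {F : ℂ → ℂ} {y : ℂ} (hF : AnalyticAt ℂ F y)
    (hmax : ∀ᶠ z in 𝓝 y, sphNorm F z ≤ sphNorm F y) (hne : sphNorm F y ≠ 0) :
    polarGradient F (y, conj y) = 0 := by
  set K := sphNorm F y with hK
  have hF' : deriv F y ≠ 0 := fun h => hne (sphNorm_eq_zero_iff.2 h)
  set N : ℂ → ℝ := fun z => ‖deriv F z‖ ^ 2 * (1 + ‖z‖ ^ 2) ^ 2 - K ^ 2 * (1 + ‖F z‖ ^ 2) ^ 2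
    with hN
  have hKe : ‖deriv F y‖ * (1 + ‖y‖ ^ 2) = K * (1 + ‖F y‖ ^ 2) := by
    rw [hK, sphNorm, div_mul_cancel₀ _ (one_add_norm_sq_ne_zero _)]
  have hN0 : N y = 0 := by
    simp only [hN]
    rw [← mul_pow, ← mul_pow, hKe, sub_self]
  have hNle : ∀ᶠ z in 𝓝 y, N z ≤ N y := by
    filter_upwards [hmax] with z hz
    rw [sphNorm, div_le_iff₀ (one_add_norm_sq_pos _)] at hz
    rw [hN0]
    simp only [hN]
    rw [← mul_pow, ← mul_pow, sub_nonpos]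
    gcongr
  set A : ℂ := conj (deriv F y) * deriv (deriv F) y * (1 + y * conj y) ^ 2 +
    2 * (deriv F y * conj (deriv F y)) * (1 + y * conj y) * conj y -
    2 * (K : ℂ) ^ 2 * (1 + F y * conj (F y)) * conj (F y) * deriv F y with hA
  -- The derivative of `N` at `y` in the direction `h` is twice this real part.
  have hre : ∀ h : ℂ, (h * A).re = 0 := by
    intro h
    have d0 : HasDerivAt (fun t : ℝ => y + t * h) h 0 := by
      simpa using hasDerivAt_comp_line (hasDerivAt_id y) h
    have d1 := (hasDerivAt_comp_line hF.differentiableAt.hasDerivAt h).norm_sq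
    have d2 := (hasDerivAt_comp_line hF.deriv.differentiableAt.hasDerivAt h).norm_sq
    have d := (d2.mul ((d0.norm_sq.const_add 1).pow 2)).sub
      (((d1.const_add 1).pow 2).const_mul (K ^ 2))
    have hloc : IsLocalMax (fun t : ℝ => N (y + t * h)) 0 := by
      have ht : Tendsto (fun t : ℝ => y + t * h) (𝓝 0) (𝓝 y) := by
        simpa using d0.continuousAt.tendsto
      simpa [IsLocalMax, IsMaxFilter] using ht.eventually hNle
    have h0 := hloc.hasDerivAt_eq_zero d
    simp only [Complex.inner, Complex.ofReal_zero, zero_mul, add_zero] at h0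
    have e : ∀ z : ℂ, z * conj z = ((‖z‖ ^ 2 : ℝ) : ℂ) := fun z => by
      rw [Complex.mul_conj', Complex.ofReal_pow]
    have hA' : h * A = ((1 + ‖y‖ ^ 2 : ℝ) ^ 2 : ℝ) * (conj (deriv F y) * (deriv (deriv F) y * h))
        + ((‖deriv F y‖ ^ 2 * (2 * (1 + ‖y‖ ^ 2)) : ℝ) : ℂ) * (conj y * h)
        - ((K ^ 2 * (2 * (1 + ‖F y‖ ^ 2)) : ℝ) : ℂ) * (conj (F y) * (deriv F y * h)) := by
      rw [hA, e, e, e]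
      push_cast
      ring
    rw [hA', Complex.sub_re, Complex.add_re, Complex.re_ofReal_mul, Complex.re_ofReal_mul,
      Complex.re_ofReal_mul]
    simp only [mul_comm (conj _)]
    simp only [Pi.pow_apply, Complex.ofReal_zero, zero_mul, add_zero, Nat.cast_ofNat,
      Nat.add_one_sub_one, pow_one] at h0
    linarith
  have hA0 : A = 0 := by
    apply Complex.ext
    · simpa using hre 1
    · simpa using hre Complex.I
  have hKc : (K : ℂ) ^ 2 * (1 + F y * conj (F y)) ^ 2 =
      deriv F y * conj (deriv F y) * (1 + y * conj y) ^ 2 := by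
    rw [Complex.mul_conj', Complex.mul_conj', Complex.mul_conj', ← mul_pow, ← mul_pow]
    exact_mod_cast congrArg (fun x : ℝ => x ^ (2 : ℕ)) hKe.symm
  have hc : conj (deriv F y) * (1 + y * conj y) ≠ 0 := by
    refine mul_ne_zero (by simpa using hF') ?_
    simpa [mul_comm] using one_add_conj_mul_self_ne_zero y
  refine (mul_eq_zero.1 ?_).resolve_left hc
  simp only [polarGradient, Complex.conj_conj]
  linear_combination (1 + F y * conj (F y)) * hA0 +
    2 * conj (F y) * deriv F y * hKc

theorem analyticAt_conj_conj {F : ℂ → ℂ} {a : ℂ} (hF : AnalyticAt ℂ F (conj a)) :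
    AnalyticAt ℂ (fun w => conj (F (conj w))) a := by
  rw [Complex.analyticAt_iff_eventually_differentiableAt] at hF ⊢
  have ht : Tendsto (conj : ℂ → ℂ) (𝓝 a) (𝓝 (conj a)) := Complex.continuous_conj.continuousAt
  filter_upwards [ht.eventually hF] with z hz
  simpa [Function.comp_def] using hz.conj_conj

/-- Near a point of maximal expansion with `sphNorm F > 1`, the conjugation coincides with a
holomorphic function on the set of points of maximal expansion. -/
theorem exists_analyticAt_eq_conj {F : ℂ → ℂ} {b : ℂ} (hF : AnalyticAt ℂ F b)
    (hmax : ∀ᶠ z in 𝓝 b, sphNorm F z ≤ sphNorm F b) (h1 : 1 < sphNorm F b) :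
    ∃ S : ℂ → ℂ, AnalyticAt ℂ S b ∧ S b = conj b ∧
      ∀ᶠ y in 𝓝 b, sphNorm F y = sphNorm F b → S y = conj y := by
  have hFs : AnalyticAt ℂ (fun w => conj (F (conj w))) (conj b) :=
    analyticAt_conj_conj (by rwa [Complex.conj_conj])
  have a1 : AnalyticAt ℂ (fun v : ℂ × ℂ => F v.1) (b, conj b) :=
    AnalyticAt.fun_comp (g := F) hF analyticAt_fst
  have a2 : AnalyticAt ℂ (fun v : ℂ × ℂ => deriv F v.1) (b, conj b) :=
    AnalyticAt.fun_comp (g := deriv F) hF.deriv analyticAt_fst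
  have a3 : AnalyticAt ℂ (fun v : ℂ × ℂ => deriv (deriv F) v.1) (b, conj b) :=
    AnalyticAt.fun_comp (g := deriv (deriv F)) hF.deriv.deriv analyticAt_fst
  have a4 : AnalyticAt ℂ (fun v : ℂ × ℂ => conj (F (conj v.2))) (b, conj b) :=
    AnalyticAt.fun_comp (g := fun w => conj (F (conj w))) hFs analyticAt_snd
  have han : AnalyticAt ℂ (polarGradient F) (b, conj b) := by
    have b1 : AnalyticAt ℂ (fun v : ℂ × ℂ => v.1) (b, conj b) := analyticAt_fst
    have b2 : AnalyticAt ℂ (fun v : ℂ × ℂ => v.2) (b, conj b) := analyticAt_snd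
    have b3 : AnalyticAt ℂ (fun v : ℂ × ℂ => 1 + v.1 * v.2) (b, conj b) :=
      analyticAt_const.add (b1.mul b2)
    exact ((analyticAt_const.add (a1.mul a4)).mul
      ((a3.mul b3).add ((analyticAt_const.mul a2).mul b2))).sub
      (((analyticAt_const.mul (a2.pow 2)).mul a4).mul b3)
  have hgrad : ∀ᶠ y in 𝓝 b, sphNorm F y = sphNorm F b → polarGradient F (y, conj y) = 0 := by
    filter_upwards [hF.eventually_analyticAt, hmax.eventually_nhds] with y hy hym hyeq
    exact polarGradient_eq_zero hy (by simpa only [hyeq] using hym) (by rw [hyeq]; linarith)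
  have h0 : polarGradient F (b, conj b) = 0 := hgrad.self_of_nhds rfl
  have hF' : deriv F b ≠ 0 := fun h => by rw [sphNorm_eq_zero_iff.2 h] at h1; linarith
  have hd : HasDerivAt (fun w => polarGradient F (b, w))
      (F b * conj (deriv F b) *
          (deriv (deriv F) b * (1 + b * conj b) + 2 * deriv F b * conj b) +
        (1 + F b * conj (F b)) * (deriv (deriv F) b * b + 2 * deriv F b) -
        (2 * deriv F b ^ 2 * conj (deriv F b) * (1 + b * conj b) +
          2 * deriv F b ^ 2 * conj (F b) * b)) (conj b) := by
    have d1 : HasDerivAt (fun w => conj (F (conj w))) (conj (deriv F b)) (conj b) :=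
      hF.differentiableAt.hasDerivAt.conj_conj
    have d2 : HasDerivAt (fun w => 1 + b * w) b (conj b) := by
      simpa using ((hasDerivAt_id _).const_mul b).const_add 1
    have d3 : HasDerivAt (fun w => 2 * deriv F b * w) (2 * deriv F b) (conj b) := by
      simpa using (hasDerivAt_id (conj b)).const_mul (2 * deriv F b)
    have := (((d1.const_mul (F b)).const_add 1).mul
      ((d2.const_mul (deriv (deriv F) b)).add d3)).sub ((d1.const_mul (2 * deriv F b ^ 2)).mul d2)
    simp only [Complex.conj_conj, Pi.add_apply] at this
    exact this
  have hKc : deriv F b * conj (deriv F b) * (1 + b * conj b) ^ 2 ≠ (1 + F b * conj (F b)) ^ 2 := by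
    rw [Complex.mul_conj', Complex.mul_conj', Complex.mul_conj', ← mul_pow]
    intro h
    have h' : (‖deriv F b‖ * (1 + ‖b‖ ^ 2)) ^ 2 = (1 + ‖F b‖ ^ 2) ^ 2 := by exact_mod_cast h
    rw [sq_eq_sq₀ (by positivity) (by positivity)] at h'
    rw [sphNorm, h', div_self (one_add_norm_sq_ne_zero _)] at h1
    exact lt_irrefl _ h1
  -- Nondegeneracy for the implicit function theorem: together with `h0`, the vanishing of this
  -- derivative would give the equality excluded by `hKc`, that is `sphNorm F b = 1`.
  have hne : deriv (fun w => polarGradient F (b, w)) (conj b) ≠ 0 := by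
    rw [hd.deriv]
    simp only [polarGradient, Complex.conj_conj] at h0
    intro hz
    apply hKc
    have h2F' : 2 * deriv F b ≠ 0 := mul_ne_zero two_ne_zero hF'
    refine mul_left_cancel₀ h2F' ?_
    linear_combination
      (F b * conj (deriv F b) * (1 + b * conj b) + (1 + F b * conj (F b)) * b) * h0 -
      (1 + F b * conj (F b)) * (1 + b * conj b) * hz
  have hcd : ContDiffAt ℂ 1 (polarGradient F) (b, conj b) := han.contDiffAt
  have hinv : (fderiv ℂ (polarGradient F) (b, conj b) ∘L .inr ℂ ℂ ℂ).IsInvertible := by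
    have hval : (fderiv ℂ (polarGradient F) (b, conj b) ∘L .inr ℂ ℂ ℂ) 1 =
        deriv (fun w => polarGradient F (b, w)) (conj b) := by
      have h2 : HasFDerivAt (fun w : ℂ => ((b, w) : ℂ × ℂ)) (.inr ℂ ℂ ℂ) (conj b) :=
        hasFDerivAt_prodMk_right b (conj b)
      have h3 := (HasFDerivAt.comp (conj b) (g := polarGradient F)
        han.differentiableAt.hasFDerivAt h2).hasDerivAt
      exact h3.deriv.symm
    refine ⟨ContinuousLinearEquiv.unitsEquivAut ℂ (Units.mk0 _ (hval ▸ hne)), ?_⟩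
    ext
    simp
  have hone : (1 : WithTop ℕ∞) ≠ 0 := one_ne_zero
  refine ⟨hcd.implicitFunction hone hinv, ?_, hcd.implicitFunction_apply_self hone hinv, ?_⟩
  · rw [Complex.analyticAt_iff_eventually_differentiableAt]
    have := hcd.contDiffAt_implicitFunction hone hinv
    filter_upwards [this.eventually (by simp)] with z hz
    exact hz.differentiableAt one_ne_zero
  · have ht : Tendsto (fun y : ℂ => (y, conj y)) (𝓝 b) (𝓝 (b, conj b)) :=
      (continuous_id.prodMk Complex.continuous_conj).continuousAt
    filter_upwards [hgrad, ht.eventually (hcd.eventually_apply_eq_iff_implicitFunction hone hinv)]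
      with y hy1 hy2 hy3
    exact hy2.1 (by rw [hy1 hy3, h0])

/-- If, at points of maximal expansion of `F`, the spherical norm of the derivative of `G` takes
the value `c` on a set that accumulates at `b`, then it takes this value at all points of maximal
expansion of `F` near `b`. -/
theorem sphNorm_eq_of_frequently {F G : ℂ → ℂ} {b : ℂ} {c : ℝ} (hF : AnalyticAt ℂ F b)
    (hG : AnalyticAt ℂ G b) (hmax : ∀ᶠ z in 𝓝 b, sphNorm F z ≤ sphNorm F b)
    (h1 : 1 < sphNorm F b) (hc : 0 ≤ c)
    (hfreq : ∃ᶠ y in 𝓝[≠] b, sphNorm F y = sphNorm F b ∧ sphNorm G y = c) :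
    ∀ᶠ y in 𝓝 b, sphNorm F y = sphNorm F b → sphNorm G y = c := by
  obtain ⟨S, hS, hSb, hSM⟩ := exists_analyticAt_eq_conj hF hmax h1
  -- `H` is the holomorphic function obtained from the squared form of `sphNorm G y = c` by
  -- replacing `conj y` with `S y`; the identity theorem applies to it.
  set H : ℂ → ℂ := fun y => deriv G y * conj (deriv G (conj (S y))) * (1 + y * S y) ^ 2 -
    (c : ℂ) ^ 2 * (1 + G y * conj (G (conj (S y)))) ^ 2 with hH
  have hGs : AnalyticAt ℂ (fun y => conj (G (conj (S y)))) b :=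
    AnalyticAt.fun_comp (g := fun w => conj (G (conj w)))
      (analyticAt_conj_conj (by rwa [hSb, Complex.conj_conj])) hS
  have hGs' : AnalyticAt ℂ (fun y => conj (deriv G (conj (S y)))) b :=
    AnalyticAt.fun_comp (g := fun w => conj (deriv G (conj w)))
      (analyticAt_conj_conj (by rw [hSb, Complex.conj_conj]; exact hG.deriv)) hS
  have hGd := hG.deriv
  have hHan : AnalyticAt ℂ H b := by
    simp only [hH]
    fun_prop
  have hiff : ∀ y, S y = conj y → (H y = 0 ↔ sphNorm G y = c) := by
    intro y hy
    simp only [hH, hy, Complex.conj_conj, sub_eq_zero]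
    rw [Complex.mul_conj', Complex.mul_conj', Complex.mul_conj', ← mul_pow, ← mul_pow, sphNorm,
      div_eq_iff (one_add_norm_sq_ne_zero _), ← sq_eq_sq₀ (a := ‖deriv G y‖ * (1 + ‖y‖ ^ 2))
        (b := c * (1 + ‖G y‖ ^ 2)) (by positivity) (by positivity)]
    norm_cast
  have hz : ∀ᶠ y in 𝓝 b, H y = 0 := by
    refine hHan.frequently_zero_iff_eventually_zero.1 ?_
    refine (hfreq.and_eventually (hSM.filter_mono nhdsWithin_le_nhds)).mono ?_
    rintro y ⟨⟨hy1, hy2⟩, hy3⟩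
    exact (hiff y (hy3 hy1)).2 hy2
  filter_upwards [hz, hSM] with y hy1 hy2 hy3
  exact (hiff y (hy2 hy3)).1 hy1

/-! ### Charts of the sphere -/

theorem inversion_coe_zero : inversion ((0 : ℂ) : Sphere) = OnePoint.infty := by
  simp [inversion]

theorem inversion_infty : inversion OnePoint.infty = ((0 : ℂ) : Sphere) := rfl

theorem inversion_coe {w : ℂ} (hw : w ≠ 0) : inversion (w : Sphere) = ((w⁻¹ : ℂ) : Sphere) := by
  simp [inversion, hw]

theorem inversion_inversion (z : Sphere) : inversion (inversion z) = z := by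
  induction z using OnePoint.rec with
  | infty => rw [inversion_infty, inversion_coe_zero]
  | coe w =>
    by_cases hw : w = 0
    · rw [hw, inversion_coe_zero, inversion_infty]
    · rw [inversion_coe hw, inversion_coe (inv_ne_zero hw), inv_inv]

theorem continuous_inversion : Continuous inversion := by
  have hcc : coclosedCompact ℂ = Bornology.cobounded ℂ := by
    rw [coclosedCompact_eq_cocompact, Metric.cobounded_eq_cocompact]
  rw [continuous_iff_continuousAt]
  intro z
  induction z using OnePoint.rec with
  | infty =>
    rw [OnePoint.continuousAt_infty', inversion_infty, hcc]
    have h1 : Tendsto (fun w : ℂ => ((w⁻¹ : ℂ) : Sphere)) (Bornology.cobounded ℂ)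
        (𝓝 ((0 : ℂ) : Sphere)) :=
      OnePoint.continuous_coe.continuousAt.tendsto.comp tendsto_inv₀_cobounded
    refine h1.congr' ?_
    filter_upwards [Bornology.eventually_ne_cobounded (0 : ℂ)] with w hw
    simp [inversion_coe hw]
  | coe a =>
    rw [OnePoint.continuousAt_coe]
    by_cases ha : a = 0
    · subst ha
      rw [ContinuousAt, Function.comp_apply, inversion_coe_zero, ← nhdsNE_sup_pure, tendsto_sup]
      constructor
      · have h1 : Tendsto (fun w : ℂ => ((w⁻¹ : ℂ) : Sphere)) (𝓝[≠] 0) (𝓝 OnePoint.infty) := by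
          refine (OnePoint.tendsto_coe_infty (X := ℂ)).comp ?_
          rw [hcc]
          exact tendsto_inv₀_nhdsNE_zero
        refine h1.congr' ?_
        filter_upwards [self_mem_nhdsWithin] with w hw
        simp [inversion_coe hw]
      · rw [tendsto_pure_left]
        intro s hs
        simpa [inversion_coe_zero] using mem_of_mem_nhds hs
    · have h1 : ContinuousAt (fun w : ℂ => ((w⁻¹ : ℂ) : Sphere)) a :=
        OnePoint.continuous_coe.continuousAt.comp (continuousAt_inv₀ ha)
      refine h1.congr ?_
      filter_upwards [eventually_ne_nhds ha] with w hw
      simp [inversion_coe hw]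

/-- The inversion as a homeomorphism. -/
def inversionHomeomorph : Sphere ≃ₜ Sphere where
  toFun := inversion
  invFun := inversion
  left_inv := inversion_inversion
  right_inv := inversion_inversion
  continuous_toFun := continuous_inversion
  continuous_invFun := continuous_inversion

/-- The inversion if `b` is true, otherwise the identity. -/
def flip (b : Bool) : Sphere ≃ₜ Sphere := if b then inversionHomeomorph else Homeomorph.refl _

/-- The two affine charts of the sphere: the inclusion of the plane, and its inversion. -/
def chart (b : Bool) (w : ℂ) : Sphere := flip b (w : Sphere)

theorem chart_false (w : ℂ) : chart false w = (w : Sphere) := rfl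

theorem chart_true (w : ℂ) : chart true w = inversion (w : Sphere) := rfl

theorem chart_true_zero : chart true 0 = OnePoint.infty := inversion_coe_zero

theorem flip_flip (b : Bool) (z : Sphere) : flip b (flip b z) = z := by
  cases b
  · rfl
  · exact inversion_inversion z

theorem isOpenEmbedding_chart (b : Bool) : IsOpenEmbedding (chart b) :=
  (flip b).isOpenEmbedding.comp OnePoint.isOpenEmbedding_coe

theorem continuous_chart (b : Bool) : Continuous (chart b) := (isOpenEmbedding_chart b).continuous

theorem chart_injective (b : Bool) : Function.Injective (chart b) :=
  (isOpenEmbedding_chart b).injective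

theorem map_chart_nhds (b : Bool) (a : ℂ) : map (chart b) (𝓝 a) = 𝓝 (chart b a) :=
  (isOpenEmbedding_chart b).map_nhds_eq a

theorem exists_chart (z : Sphere) : ∃ b a, chart b a = z := by
  induction z using OnePoint.rec with
  | infty => exact ⟨true, 0, chart_true_zero⟩
  | coe w => exact ⟨false, w, rfl⟩

theorem chart_not_inv (b : Bool) {w : ℂ} (hw : w ≠ 0) : chart (!b) w⁻¹ = chart b w := by
  cases b
  · simp [chart_false, chart_true, inversion_coe (inv_ne_zero hw)]
  · simp [chart_false, chart_true, inversion_coe hw]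

theorem chart_eq_chart_not {b : Bool} {w v : ℂ} (h : chart (!b) w = chart b v) :
    v ≠ 0 ∧ w = v⁻¹ := by
  by_cases hv : v = 0
  · exfalso
    subst hv
    cases b
    · simp only [Bool.not_false, chart_true, chart_false] at h
      have := congrArg inversion h
      rw [inversion_inversion, inversion_coe_zero] at this
      exact OnePoint.coe_ne_infty w this
    · rw [chart_true_zero] at h
      exact OnePoint.coe_ne_infty w h
  · exact ⟨hv, chart_injective _ (h.trans (chart_not_inv b hv).symm)⟩

/-- The map `F` is given by the holomorphic function `g` in the charts `b` (near the point with
coordinate `a`) and `c`. -/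
structure HasRep (F : Sphere → Sphere) (b c : Bool) (g : ℂ → ℂ) (a : ℂ) : Prop where
  analyticAt : AnalyticAt ℂ g a
  eventually_eq : ∀ᶠ w in 𝓝 a, F (chart b w) = chart c (g w)

namespace HasRep

variable {F G : Sphere → Sphere} {b c d : Bool} {g h : ℂ → ℂ} {a : ℂ}

theorem apply (H : HasRep F b c g a) : F (chart b a) = chart c (g a) := H.eventually_eq.self_of_nhds

theorem comp (HG : HasRep G c d h (g a)) (HF : HasRep F b c g a) : HasRep (G ∘ F) b d (h ∘ g) a where
  analyticAt := HG.analyticAt.comp HF.analyticAt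
  eventually_eq := by
    filter_upwards [HF.eventually_eq, HF.analyticAt.continuousAt.tendsto.eventually HG.eventually_eq]
      with w h1 h2
    rw [Function.comp_apply, h1, h2, Function.comp_apply]

theorem eventually (H : HasRep F b c g a) : ∀ᶠ w in 𝓝 a, HasRep F b c g w := by
  filter_upwards [H.analyticAt.eventually_analyticAt, H.eventually_eq.eventually_nhds] with w h1 h2
  exact ⟨h1, h2⟩

theorem swap_source (H : HasRep F b c g a) (ha : a ≠ 0) :
    HasRep F (!b) c (g ∘ fun z => z⁻¹) a⁻¹ where
  analyticAt := by
    refine AnalyticAt.comp ?_ (analyticAt_inv (inv_ne_zero ha))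
    rw [inv_inv]
    exact H.analyticAt
  eventually_eq := by
    have ht : Tendsto (fun z : ℂ => z⁻¹) (𝓝 a⁻¹) (𝓝 a) := by
      simpa using (continuousAt_inv₀ (inv_ne_zero ha)).tendsto
    filter_upwards [ht.eventually H.eventually_eq, eventually_ne_nhds (inv_ne_zero ha)] with w h1 h2
    rw [Function.comp_apply, ← h1, ← chart_not_inv b (inv_ne_zero h2), inv_inv]

theorem swap_target (H : HasRep F b c g a) (ha : g a ≠ 0) :
    HasRep F b (!c) ((fun z => z⁻¹) ∘ g) a where
  analyticAt := (analyticAt_inv ha).comp H.analyticAt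
  eventually_eq := by
    filter_upwards [H.eventually_eq, H.analyticAt.continuousAt.eventually_ne ha] with w h1 h2
    rw [h1, Function.comp_apply, chart_not_inv c h2]

theorem exists_source (H : HasRep F b c g a) {b' : Bool} {a' : ℂ} (h : chart b' a' = chart b a) :
    ∃ g', HasRep F b' c g' a' := by
  by_cases hb : b' = b
  · subst hb
    rw [chart_injective _ h]
    exact ⟨g, H⟩
  · obtain rfl : b' = !b := by cases b <;> cases b' <;> simp_all
    obtain ⟨h1, rfl⟩ := chart_eq_chart_not h
    exact ⟨_, H.swap_source h1⟩

theorem exists_target (H : HasRep F b c g a) {c' : Bool} {e : ℂ} (h : chart c' e = F (chart b a)) :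
    ∃ g', HasRep F b c' g' a ∧ g' a = e := by
  rw [H.apply] at h
  by_cases hb : c' = c
  · subst hb
    exact ⟨g, H, (chart_injective _ h).symm⟩
  · obtain rfl : c' = !c := by cases c <;> cases c' <;> simp_all
    obtain ⟨h1, rfl⟩ := chart_eq_chart_not h
    exact ⟨_, H.swap_target h1, rfl⟩

/-- The side conditions allow the inverted chart only at `∞`, which is exactly where `flipAt`
inverts. The charts are then the ones used in the definition of `sphDeriv`. -/
theorem sphDeriv_eq_aux (H : HasRep F b c g a) (hb : b = false ∨ a = 0) (hc : c = false ∨ g a = 0) :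
    sphDeriv F (chart b a) = sphNorm g a := by
  have key : ∀ (b : Bool) (a : ℂ), b = false ∨ a = 0 → flipAt (chart b a) = flip b := by
    rintro b a (rfl | rfl)
    · rfl
    · cases b
      · rfl
      · rw [chart_true_zero]; rfl
  have h1 : coord (flip b (chart b a)) = a := by
    rw [chart, flip_flip]; rfl
  rw [sphDeriv, H.apply, key b a hb, key c (g a) hc, h1]
  refine sphNorm_congr ?_
  filter_upwards [H.eventually_eq] with w hw
  simp only [Function.comp_apply]
  change coord (flip c (F (chart b w))) = g w
  rw [hw, chart, flip_flip]
  rfl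

/-- The spherical derivative can be computed in any charts. -/
theorem sphDeriv_eq (H : HasRep F b c g a) : sphDeriv F (chart b a) = sphNorm g a := by
  have hinv : ∀ {z : ℂ}, z ≠ 0 → DifferentiableAt ℂ (fun z : ℂ => z⁻¹) z :=
    fun hz => differentiableAt_inv hz
  -- Any other chart is exchanged for the standard one, first at the source and then at the target;
  -- the transition `z⁻¹` has spherical norm `1`.
  have source : ∀ {c : Bool} {g : ℂ → ℂ}, HasRep F b c g a → c = false ∨ g a = 0 →
      sphDeriv F (chart b a) = sphNorm g a := by
    intro c g H hc
    by_cases hb : b = false ∨ a = 0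
    · exact H.sphDeriv_eq_aux hb hc
    · push Not at hb
      obtain rfl : b = true := by simpa using hb.1
      have h2 := (H.swap_source hb.2).sphDeriv_eq_aux (Or.inl rfl) (by simpa using hc)
      rw [chart_not_inv true hb.2] at h2
      rw [h2, sphNorm_comp (by rw [inv_inv]; exact H.analyticAt.differentiableAt)
        (hinv (inv_ne_zero hb.2)), sphNorm_inv (inv_ne_zero hb.2), inv_inv, mul_one]
  by_cases hc : c = false ∨ g a = 0
  · exact source H hc
  · push Not at hc
    obtain rfl : c = true := by simpa using hc.1
    rw [source (H.swap_target hc.2) (Or.inl rfl),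
      sphNorm_comp (hinv hc.2) H.analyticAt.differentiableAt, sphNorm_inv hc.2, one_mul]

end HasRep

/-! ### Holomorphic self-maps of the sphere and their maximal expansion -/

/-- Holomorphy of a self-map of the sphere. -/
def HolAt (F : Sphere → Sphere) (z : Sphere) : Prop :=
  ∃ b c g a, chart b a = z ∧ HasRep F b c g a

namespace HolAt

variable {F G : Sphere → Sphere} {z : Sphere}

theorem exists_rep (H : HolAt F z) {b c : Bool} {a e : ℂ} (h1 : chart b a = z)
    (h2 : chart c e = F z) : ∃ g, HasRep F b c g a ∧ g a = e := by
  obtain ⟨b', c', g, a', rfl, hg⟩ := H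
  obtain ⟨g', hg'⟩ := hg.exists_source h1
  rw [← h1] at h2
  exact hg'.exists_target h2

theorem id : HolAt id z := by
  obtain ⟨b, a, rfl⟩ := exists_chart z
  exact ⟨b, b, _root_.id, a, rfl, analyticAt_id, Eventually.of_forall fun _ => rfl⟩

theorem exists_rep_comp (HG : HolAt G (F z)) (HF : HolAt F z) :
    ∃ b c d g h a, chart b a = z ∧ HasRep F b c g a ∧ HasRep G c d h (g a) := by
  obtain ⟨b, c, g, a, rfl, hg⟩ := HF
  obtain ⟨d, e, he⟩ := exists_chart (G (F (chart b a)))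
  obtain ⟨h, hh, -⟩ := HG.exists_rep hg.apply.symm he
  exact ⟨b, c, d, g, h, a, rfl, hg, hh⟩

theorem comp (HG : HolAt G (F z)) (HF : HolAt F z) : HolAt (G ∘ F) z := by
  obtain ⟨b, c, d, g, h, a, hz, hg, hh⟩ := exists_rep_comp HG HF
  exact ⟨b, d, _, a, hz, hh.comp hg⟩

theorem sphDeriv_comp (HG : HolAt G (F z)) (HF : HolAt F z) :
    sphDeriv (G ∘ F) z = sphDeriv G (F z) * sphDeriv F z := by
  obtain ⟨b, c, d, g, h, a, rfl, hg, hh⟩ := exists_rep_comp HG HF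
  rw [(hh.comp hg).sphDeriv_eq, hg.sphDeriv_eq, hg.apply, hh.sphDeriv_eq,
    sphNorm_comp hh.analyticAt.differentiableAt hg.analyticAt.differentiableAt]

theorem continuousAt (H : HolAt F z) : ContinuousAt F z := by
  obtain ⟨b, c, g, a, rfl, hg⟩ := H
  rw [ContinuousAt, ← map_chart_nhds, tendsto_map'_iff, hg.apply]
  have : Tendsto (fun w => chart c (g w)) (𝓝 a) (𝓝 (chart c (g a))) :=
    (continuous_chart c).continuousAt.tendsto.comp hg.analyticAt.continuousAt
  exact this.congr' (hg.eventually_eq.mono fun w hw => hw.symm)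

theorem continuousAt_sphDeriv (H : HolAt F z) : ContinuousAt (sphDeriv F) z := by
  obtain ⟨b, c, g, a, rfl, hg⟩ := H
  rw [ContinuousAt, ← map_chart_nhds, tendsto_map'_iff, hg.sphDeriv_eq]
  exact (continuousAt_sphNorm hg.analyticAt).tendsto.congr'
    (hg.eventually.mono fun w hw => hw.sphDeriv_eq.symm)

theorem sphDeriv_nonneg (H : HolAt F z) : 0 ≤ sphDeriv F z := by
  obtain ⟨b, c, g, a, rfl, hg⟩ := H
  rw [hg.sphDeriv_eq]
  exact sphNorm_nonneg g a

end HolAt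

theorem sphDeriv_id (z : Sphere) : sphDeriv id z = 1 := by
  obtain ⟨b, a, rfl⟩ := exists_chart z
  have h : HasRep id b b _root_.id a := ⟨analyticAt_id, Eventually.of_forall fun _ => rfl⟩
  rw [h.sphDeriv_eq, sphNorm_id]

/-- Holomorphy on the whole sphere. -/
def Hol (F : Sphere → Sphere) : Prop := ∀ z, HolAt F z

namespace Hol

variable {F G : Sphere → Sphere}

theorem comp (HG : Hol G) (HF : Hol F) : Hol (G ∘ F) := fun z => (HG _).comp (HF z)

theorem iterate (H : Hol F) (n : ℕ) : Hol F^[n] := by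
  induction n with
  | zero => exact fun z => HolAt.id
  | succ n ih =>
    rw [Function.iterate_succ]
    exact ih.comp H

theorem continuous (H : Hol F) : Continuous F :=
  continuous_iff_continuousAt.2 fun z => (H z).continuousAt

theorem continuous_sphDeriv (H : Hol F) : Continuous (sphDeriv F) :=
  continuous_iff_continuousAt.2 fun z => (H z).continuousAt_sphDeriv

theorem isGreatest_supDeriv (H : Hol F) : IsGreatest (Set.range (sphDeriv F)) (supDeriv F) :=
  (isCompact_range H.continuous_sphDeriv).isGreatest_sSup (Set.range_nonempty _)

theorem sphDeriv_le (H : Hol F) (z : Sphere) : sphDeriv F z ≤ supDeriv F :=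
  H.isGreatest_supDeriv.2 ⟨z, rfl⟩

theorem exists_sphDeriv_eq (H : Hol F) : ∃ z, sphDeriv F z = supDeriv F := H.isGreatest_supDeriv.1

theorem supDeriv_nonneg (H : Hol F) : 0 ≤ supDeriv F := by
  obtain ⟨z, hz⟩ := H.exists_sphDeriv_eq
  rw [← hz]
  exact (H z).sphDeriv_nonneg

theorem supDeriv_comp_le (HG : Hol G) (HF : Hol F) :
    supDeriv (G ∘ F) ≤ supDeriv G * supDeriv F := by
  obtain ⟨z, hz⟩ := (HG.comp HF).exists_sphDeriv_eq
  rw [← hz, HolAt.sphDeriv_comp (HG _) (HF z)]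
  exact mul_le_mul (HG.sphDeriv_le _) (HF.sphDeriv_le z) (HF z).sphDeriv_nonneg HG.supDeriv_nonneg

theorem sphDeriv_iterate (H : Hol F) (n : ℕ) (z : Sphere) :
    sphDeriv F^[n] z = ∏ i ∈ Finset.range n, sphDeriv F (F^[i] z) := by
  induction n with
  | zero => simpa using sphDeriv_id z
  | succ n ih =>
    rw [Function.iterate_succ', HolAt.sphDeriv_comp (H _) (H.iterate n z), ih,
      Finset.prod_range_succ, mul_comm]

theorem isClosed_maxSet (H : Hol F) : IsClosed (maxSet F) :=
  isClosed_eq H.continuous_sphDeriv continuous_const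

/-- The maximal expansion of a holomorphic map that has critical points but is not constant
exceeds `1`. -/
theorem one_lt_supDeriv (H : Hol F) (h0 : ∃ z, sphDeriv F z = 0) (h1 : ∃ z, sphDeriv F z ≠ 0) :
    1 < supDeriv F := by
  by_contra hle
  push Not at hle
  -- When `supDeriv F ≤ 1`, the local maximum principle makes the closed set `maxSet F` open as
  -- well, hence the whole connected sphere, and `sphDeriv F` is constant.
  have hopen : IsOpen (maxSet F) := by
    rw [isOpen_iff_mem_nhds]
    intro z hz
    obtain ⟨b, c, g, a, rfl, hg⟩ := H z
    have hz' : sphNorm g a = supDeriv F := hg.sphDeriv_eq.symm.trans hz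
    have hmax : ∀ᶠ w in 𝓝 a, sphNorm g w ≤ sphNorm g a := by
      filter_upwards [hg.eventually] with w hw
      rw [hz', ← hw.sphDeriv_eq]
      exact H.sphDeriv_le _
    rw [← map_chart_nhds, mem_map]
    filter_upwards [hg.eventually, sphNorm_eventually_eq hg.analyticAt hmax (hz'.trans_le hle)]
      with w hw1 hw2
    exact hw1.sphDeriv_eq.trans (hw2.trans hz')
  have huniv : maxSet F = Set.univ :=
    IsClopen.eq_univ ⟨H.isClosed_maxSet, hopen⟩ H.exists_sphDeriv_eq
  obtain ⟨z, hz⟩ := h0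
  obtain ⟨w, hw⟩ := h1
  have hz2 : z ∈ maxSet F := huniv ▸ Set.mem_univ z
  have hw2 : w ∈ maxSet F := huniv ▸ Set.mem_univ w
  exact hw (hw2.trans (hz2.symm.trans hz))

end Hol

section RationalMap

open Polynomial

/-! ### The self-map induced by a rational function -/

/-- The quotient of two complex numbers as a point of the sphere. -/
def sphereDiv (x y : ℂ) : Sphere := if y = 0 then OnePoint.infty else ((x / y : ℂ) : Sphere)

theorem sphereDiv_of_ne {x y : ℂ} (hy : y ≠ 0) : sphereDiv x y = chart false (x / y) := if_neg hy

theorem sphereDiv_of_ne' {x y : ℂ} (hx : x ≠ 0) : sphereDiv x y = chart true (y / x) := by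
  by_cases hy : y = 0
  · rw [sphereDiv, if_pos hy, hy, zero_div, chart_true_zero]
  · rw [sphereDiv_of_ne hy, ← chart_not_inv false (div_ne_zero hx hy), inv_div]
    rfl

theorem sphereDiv_mul_right {x y t : ℂ} (ht : t ≠ 0) :
    sphereDiv (x * t) (y * t) = sphereDiv x y := by
  simp [sphereDiv, ht, mul_div_mul_right]

theorem hasRep_div {F : Sphere → Sphere} {b : Bool} {P Q : ℂ → ℂ} {a : ℂ}
    (hP : AnalyticAt ℂ P a) (hQ : AnalyticAt ℂ Q a)
    (hF : ∀ w, F (chart b w) = sphereDiv (P w) (Q w)) (h : Q a ≠ 0) :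
    HasRep F b false (fun w => P w / Q w) a where
  analyticAt := hP.fun_div hQ h
  eventually_eq := by
    filter_upwards [hQ.continuousAt.eventually_ne h] with w hw
    rw [hF, sphereDiv_of_ne hw]

theorem hasRep_div' {F : Sphere → Sphere} {b : Bool} {P Q : ℂ → ℂ} {a : ℂ}
    (hP : AnalyticAt ℂ P a) (hQ : AnalyticAt ℂ Q a)
    (hF : ∀ w, F (chart b w) = sphereDiv (P w) (Q w)) (h : P a ≠ 0) :
    HasRep F b true (fun w => Q w / P w) a where
  analyticAt := hQ.fun_div hP h
  eventually_eq := by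
    filter_upwards [hP.continuousAt.eventually_ne h] with w hw
    rw [hF, sphereDiv_of_ne' hw]

theorem holAt_of_eq_sphereDiv {F : Sphere → Sphere} {b : Bool} {P Q : ℂ → ℂ} {a : ℂ}
    (hP : AnalyticAt ℂ P a) (hQ : AnalyticAt ℂ Q a)
    (hF : ∀ w, F (chart b w) = sphereDiv (P w) (Q w)) (h : P a ≠ 0 ∨ Q a ≠ 0) :
    HolAt F (chart b a) := by
  rcases h with h | h
  · exact ⟨_, _, _, _, rfl, hasRep_div' hP hQ hF h⟩
  · exact ⟨_, _, _, _, rfl, hasRep_div hP hQ hF h⟩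

theorem analyticAt_eval (p : ℂ[X]) (a : ℂ) : AnalyticAt ℂ (fun w => p.eval w) a :=
  AnalyticOnNhd.eval_polynomial p a (Set.mem_univ a)

theorem eval_reflect_mul_pow {p : ℂ[X]} {N : ℕ} (hN : p.natDegree ≤ N) {w : ℂ} (hw : w ≠ 0) :
    (reflect N p).eval w * w⁻¹ ^ N = p.eval w⁻¹ := by
  let _ : Invertible w⁻¹ := invertibleOfNonzero (inv_ne_zero hw)
  have h := eval₂_reflect_mul_pow (RingHom.id ℂ) w⁻¹ N p hN
  simpa [Polynomial.eval₂_id] using h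

theorem eval_reflect_zero (p : ℂ[X]) (N : ℕ) : (reflect N p).eval 0 = p.coeff N := by
  rw [← coeff_zero_eq_eval_zero, coeff_reflect, revAt_zero]

variable (f : RatFunc ℂ)

theorem toSphereMap_chart_false (w : ℂ) :
    toSphereMap f (chart false w) = sphereDiv (f.num.eval w) (f.denom.eval w) := rfl

/-- Numerator and denominator at `w⁻¹` are both multiplied by `w ^ d`, with `d` the degree of `f`.
At `w = 0` the reversed polynomials yield the coefficients that define the value at `∞`. -/
theorem toSphereMap_chart_true (w : ℂ) : toSphereMap f (chart true w) =
    sphereDiv ((reflect (ratDegree f) f.num).eval w) ((reflect (ratDegree f) f.denom).eval w) := by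
  by_cases hw : w = 0
  · subst hw
    rw [chart_true_zero, eval_reflect_zero, eval_reflect_zero]
    rfl
  · rw [← chart_not_inv true hw, Bool.not_true, toSphereMap_chart_false,
      ← eval_reflect_mul_pow (le_max_left _ f.denom.natDegree) hw,
      ← eval_reflect_mul_pow (le_max_right f.num.natDegree _) hw,
      sphereDiv_mul_right (pow_ne_zero _ (inv_ne_zero hw))]
    rfl

theorem eval_num_ne_zero_or (w : ℂ) : f.num.eval w ≠ 0 ∨ f.denom.eval w ≠ 0 := by
  by_contra! h
  obtain ⟨u, v, huv⟩ := f.isCoprime_num_denom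
  have := congrArg (Polynomial.eval w) huv
  simp [h.1, h.2] at this

theorem hol_toSphereMap : Hol (toSphereMap f) := by
  intro z
  induction z using OnePoint.rec with
  | infty =>
    rw [← chart_true_zero]
    refine holAt_of_eq_sphereDiv (analyticAt_eval _ _) (analyticAt_eval _ _)
      (toSphereMap_chart_true f) ?_
    rw [eval_reflect_zero, eval_reflect_zero]
    rcases le_total f.denom.natDegree f.num.natDegree with h | h
    · by_cases h0 : f.num = 0
      · right
        have hd : f.denom.natDegree = 0 := by rw [h0] at h; simpa using h
        rw [ratDegree, max_eq_left h, h0, natDegree_zero, ← hd]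
        exact leadingCoeff_ne_zero.2 f.denom_ne_zero
      · left
        rw [ratDegree, max_eq_left h]
        exact leadingCoeff_ne_zero.2 h0
    · right
      rw [ratDegree, max_eq_right h]
      exact leadingCoeff_ne_zero.2 f.denom_ne_zero
  | coe w =>
    exact holAt_of_eq_sphereDiv (b := false) (analyticAt_eval _ _) (analyticAt_eval _ _)
      (toSphereMap_chart_false f) (eval_num_ne_zero_or f w)

/-! ### Critical points and the Wronskian -/

/-- With `W` the Wronskian of `p` and `q`, the derivatives of `q / p` and `p / q` are `W / p ^ 2`
and `-W / q ^ 2`. At least one of the two quotients is available at each finite point. -/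
theorem sphDeriv_toSphereMap_eq_zero_iff (w : ℂ) :
    sphDeriv (toSphereMap f) (w : Sphere) = 0 ↔ (wronskian f.num f.denom).eval w = 0 := by
  have hp := f.num.hasDerivAt w
  have hq := f.denom.hasDerivAt w
  change sphDeriv (toSphereMap f) (chart false w) = 0 ↔ _
  rw [wronskian]
  simp only [eval_sub, eval_mul]
  rcases eval_num_ne_zero_or f w with h | h
  · rw [(hasRep_div' (analyticAt_eval _ _) (analyticAt_eval _ _)
      (toSphereMap_chart_false f) h).sphDeriv_eq, sphNorm_eq_zero_iff, (hq.fun_div hp h).deriv,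
      div_eq_zero_iff, or_iff_left (pow_ne_zero 2 h)]
    refine Eq.congr ?_ rfl
    ring
  · rw [(hasRep_div (analyticAt_eval _ _) (analyticAt_eval _ _)
      (toSphereMap_chart_false f) h).sphDeriv_eq, sphNorm_eq_zero_iff, (hp.fun_div hq h).deriv,
      div_eq_zero_iff, or_iff_left (pow_ne_zero 2 h), ← neg_eq_zero]
    refine Eq.congr ?_ rfl
    ring

/-- By coprimality `p` divides its second derivative, which has smaller degree. -/
theorem derivative_derivative_eq_zero_of_dvd {p q : ℂ[X]} (hpq : IsCoprime p q)
    (h : p ∣ derivative (derivative p) * q) : derivative (derivative p) = 0 := by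
  by_cases hp : p = 0
  · simp [hp]
  refine eq_zero_of_dvd_of_degree_lt (hpq.dvd_of_dvd_mul_right h) ?_
  by_cases hp' : derivative p = 0
  · simpa [hp'] using bot_lt_iff_ne_bot.2 (degree_ne_bot.2 hp)
  · exact (degree_derivative_lt hp').trans (degree_derivative_lt hp)

theorem natDegree_le_one_of_derivative_derivative_eq_zero {p : ℂ[X]}
    (h : derivative (derivative p) = 0) : p.natDegree ≤ 1 := by
  have h1 := derivative_eq_zero.1 h
  rw [natDegree_derivative] at h1
  omega

/-- The Wronskian of coprime polynomials is not constant, unless both have degree at most `1`. -/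
theorem natDegree_wronskian_ne_zero {p q : ℂ[X]} (hpq : IsCoprime p q)
    (hd : 2 ≤ max p.natDegree q.natDegree) : (wronskian p q).natDegree ≠ 0 := by
  intro h
  have h1 : derivative (wronskian p q) = 0 := by
    rw [eq_C_of_natDegree_eq_zero h, derivative_C]
  -- The terms with first derivatives only cancel in the derivative of the Wronskian.
  have h2 : p * derivative (derivative q) = derivative (derivative p) * q := by
    rw [wronskian, derivative_sub, derivative_mul, derivative_mul] at h1
    linear_combination h1
  have hp := natDegree_le_one_of_derivative_derivative_eq_zero
    (derivative_derivative_eq_zero_of_dvd hpq ⟨_, h2.symm⟩)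
  have hq := natDegree_le_one_of_derivative_derivative_eq_zero
    (derivative_derivative_eq_zero_of_dvd hpq.symm ⟨derivative (derivative p), by
      linear_combination h2⟩)
  have := max_le hp hq
  omega

variable {f}

theorem natDegree_wronskian_num_denom_ne_zero (hf : 2 ≤ ratDegree f) :
    (wronskian f.num f.denom).natDegree ≠ 0 :=
  natDegree_wronskian_ne_zero f.isCoprime_num_denom hf

theorem exists_sphDeriv_toSphereMap_eq_zero (hf : 2 ≤ ratDegree f) :
    ∃ z, sphDeriv (toSphereMap f) z = 0 := by
  obtain ⟨w, hw⟩ := Complex.exists_root (f := wronskian f.num f.denom)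
    (natDegree_pos_iff_degree_pos.1 (natDegree_wronskian_num_denom_ne_zero hf).bot_lt)
  exact ⟨(w : Sphere), (sphDeriv_toSphereMap_eq_zero_iff f w).2 hw⟩

theorem finite_of_coe_mem_roots {s : Set Sphere} {p : ℂ[X]} (hp : p ≠ 0)
    (h : ∀ w : ℂ, (w : Sphere) ∈ s → p.eval w = 0) : s.Finite := by
  have hfin : {w : ℂ | p.eval w = 0}.Finite := by
    refine p.roots.toFinset.finite_toSet.subset fun w hw => ?_
    simpa [hp] using hw
  refine ((hfin.image ((↑) : ℂ → Sphere)).insert OnePoint.infty).subset fun z hz => ?_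
  induction z using OnePoint.rec with
  | infty => exact Set.mem_insert _ _
  | coe w => exact Set.mem_insert_of_mem _ ⟨w, h w hz, rfl⟩

theorem finite_sphDeriv_toSphereMap_eq_zero (hf : 2 ≤ ratDegree f) :
    {z | sphDeriv (toSphereMap f) z = 0}.Finite := by
  refine finite_of_coe_mem_roots (p := wronskian f.num f.denom) ?_
    fun w hw => (sphDeriv_toSphereMap_eq_zero_iff f w).1 hw
  intro h
  exact natDegree_wronskian_num_denom_ne_zero hf (by rw [h, natDegree_zero])

theorem finite_preimage_toSphereMap (hf : 2 ≤ ratDegree f) (z : Sphere) :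
    (toSphereMap f ⁻¹' {z}).Finite := by
  induction z using OnePoint.rec with
  | infty =>
    refine finite_of_coe_mem_roots f.denom_ne_zero fun w hw => ?_
    by_contra h
    change sphereDiv _ _ = OnePoint.infty at hw
    rw [sphereDiv_of_ne h] at hw
    exact OnePoint.coe_ne_infty _ hw
  | coe c =>
    refine finite_of_coe_mem_roots (p := f.num - C c * f.denom) ?_ fun w hw => ?_
    · intro h
      rw [sub_eq_zero] at h
      have hunit : IsUnit f.denom :=
        f.isCoprime_num_denom.isUnit_of_dvd' ⟨C c, by rw [h, mul_comm]⟩ dvd_rfl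
      have h1 : f.denom.natDegree = 0 := natDegree_eq_zero_of_isUnit hunit
      have h2 : f.num.natDegree ≤ f.denom.natDegree := by
        rw [h]
        exact natDegree_C_mul_le _ _
      have := max_le (h2.trans h1.le) h1.le
      rw [ratDegree] at hf
      omega
    · change sphereDiv _ _ = (c : Sphere) at hw
      by_cases h : f.denom.eval w = 0
      · rw [sphereDiv, if_pos h] at hw
        exact absurd hw (OnePoint.infty_ne_coe c)
      · rw [sphereDiv, if_neg h, OnePoint.coe_eq_coe, div_eq_iff h] at hw
        simp [hw]

/-- By the chain rule the critical points of the iterate lie in finitely many iterated preimages of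
the critical set of `f`. These are finite, because the critical set and all fibres are. -/
theorem exists_sphDeriv_iterate_ne_zero (hf : 2 ≤ ratDegree f) (n : ℕ) :
    ∃ z, sphDeriv (toSphereMap f)^[n] z ≠ 0 := by
  set F := toSphereMap f
  have hpre : ∀ i : ℕ, (F^[i] ⁻¹' {z | sphDeriv F z = 0}).Finite := by
    intro i
    induction i with
    | zero => exact finite_sphDeriv_toSphereMap_eq_zero hf
    | succ i ih =>
      rw [Function.iterate_succ, Set.preimage_comp]
      exact ih.preimage' fun b _ => finite_preimage_toSphereMap hf b
  have hfin : {z | sphDeriv F^[n] z = 0}.Finite := by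
    refine ((Finset.range n).finite_toSet.biUnion fun i _ => hpre i).subset fun z hz => ?_
    have hz' : sphDeriv F^[n] z = 0 := hz
    rw [(hol_toSphereMap f).sphDeriv_iterate, Finset.prod_eq_zero_iff] at hz'
    obtain ⟨i, hi, h⟩ := hz'
    exact Set.mem_biUnion hi h
  have : Infinite Sphere := Infinite.of_injective _ (OnePoint.coe_injective (X := ℂ))
  obtain ⟨z, hz⟩ := hfin.exists_notMem
  exact ⟨z, hz⟩

theorem exists_sphDeriv_iterate_eq_zero (hf : 2 ≤ ratDegree f) {n : ℕ} (hn : n ≠ 0) :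
    ∃ z, sphDeriv (toSphereMap f)^[n] z = 0 := by
  obtain ⟨z, hz⟩ := exists_sphDeriv_toSphereMap_eq_zero hf
  refine ⟨z, ?_⟩
  rw [(hol_toSphereMap f).sphDeriv_iterate]
  exact Finset.prod_eq_zero (Finset.mem_range.2 hn.bot_lt) hz

theorem one_lt_supDeriv_iterate (hf : 2 ≤ ratDegree f) {n : ℕ} (hn : n ≠ 0) :
    1 < supDeriv (toSphereMap f)^[n] :=
  ((hol_toSphereMap f).iterate n).one_lt_supDeriv (exists_sphDeriv_iterate_eq_zero hf hn)
    (exists_sphDeriv_iterate_ne_zero hf n)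

theorem one_lt_supDeriv_toSphereMap (hf : 2 ≤ ratDegree f) : 1 < supDeriv (toSphereMap f) := by
  simpa using one_lt_supDeriv_iterate hf one_ne_zero

end RationalMap

/-! ### Periodic points of maps with contracting lifts -/

section Lifting

variable {X : Type*} [MetricSpace X] {T : X → X} {s : Set X} {r δ : ℝ}

/-- A lift is no farther from the orbit than the point lifted, since `r < 1`. It therefore stays
within the range `δ` where the next lift exists. -/
theorem exists_iterate_lift (hr0 : 0 ≤ r) (hr1 : r < 1) (hT : Set.MapsTo T s s)
    (hlift : ∀ x ∈ s, ∀ y ∈ s, dist y (T x) < δ → ∃ x' ∈ s, T x' = y ∧ dist x' x ≤ r * dist y (T x))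
    (n : ℕ) : ∀ x ∈ s, ∀ y ∈ s, dist y (T^[n] x) < δ →
      ∃ x' ∈ s, T^[n] x' = y ∧ dist x' x ≤ r ^ n * dist y (T^[n] x) := by
  induction n with
  | zero => exact fun x _ y hy _ => ⟨y, hy, rfl, by simp⟩
  | succ n ih =>
    intro x hx y hy hxy
    rw [Function.iterate_succ_apply'] at hxy ⊢
    obtain ⟨y', hy', hTy, hd⟩ := hlift _ (hT.iterate n hx) y hy hxy
    have hd' : dist y' (T^[n] x) < δ :=
      (hd.trans (mul_le_of_le_one_left dist_nonneg hr1.le)).trans_lt hxy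
    obtain ⟨x', hx', hTx, hdx⟩ := ih x hx y' hy' hd'
    refine ⟨x', hx', by rw [Function.iterate_succ_apply', hTx, hTy], hdx.trans ?_⟩
    rw [pow_succ, mul_assoc]
    gcongr

/-- A continuous map of a compact set, with local contracting lifts, has a periodic point. -/
theorem exists_mem_periodicPts_of_lift (hs : IsCompact s) (hne : s.Nonempty) (hcont : Continuous T)
    (hT : Set.MapsTo T s s) (hr0 : 0 ≤ r) (hr1 : r < 1)
    (hlift : ∀ z ∈ s, ∀ᶠ p in 𝓝 (z, T z), p.1 ∈ s → p.2 ∈ s →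
      ∃ x' ∈ s, T x' = p.2 ∧ dist x' p.1 ≤ r * dist p.2 (T p.1)) :
    ∃ z ∈ s, z ∈ Function.periodicPts T := by
  -- The graph of `T` over `s` is compact, so the local lifts exist at a uniform distance `δ`.
  obtain ⟨δ, hδ, hδs⟩ : ∃ δ > 0, ∀ x ∈ s, ∀ y ∈ s, dist y (T x) < δ →
      ∃ x' ∈ s, T x' = y ∧ dist x' x ≤ r * dist y (T x) := by
    have hgraph : IsCompact ((fun x => (x, T x)) '' s) := hs.image (by fun_prop)
    obtain ⟨δ, hδ, hsub⟩ := hgraph.exists_thickening_subset_open isOpen_interior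
      (by rintro _ ⟨z, hz, rfl⟩; exact mem_interior_iff_mem_nhds.2 (hlift z hz))
    refine ⟨δ, hδ, fun x hx y hy hxy => ?_⟩
    have hmem : (x, y) ∈ Metric.thickening δ ((fun x => (x, T x)) '' s) :=
      Metric.mem_thickening_iff.2 ⟨(x, T x), ⟨x, hx, rfl⟩, by simpa [Prod.dist_eq, hδ] using hxy⟩
    exact interior_subset (hsub hmem) hx hy
  -- Two terms of a convergent subsequence of an orbit give a return to within `δ`.
  obtain ⟨x₀, hx₀, p, hp, hclose⟩ : ∃ x ∈ s, ∃ p, p ≠ 0 ∧ dist x (T^[p] x) < δ := by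
    obtain ⟨z, hz⟩ := hne
    obtain ⟨a, -, φ, hφ, hlim⟩ := hs.tendsto_subseq fun n => hT.iterate n hz
    obtain ⟨N, hN⟩ := Metric.cauchySeq_iff'.1 hlim.cauchySeq δ hδ
    have hlt : φ N < φ (N + 1) := hφ N.lt_succ_self
    refine ⟨T^[φ N] z, hT.iterate _ hz, φ (N + 1) - φ N, by omega, ?_⟩
    rw [← Function.iterate_add_apply, Nat.sub_add_cancel hlt.le, dist_comm]
    exact hN (N + 1) N.le_succ
  obtain ⟨x, hx, hmin⟩ := hs.exists_isMinOn ⟨x₀, hx₀⟩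
    (f := fun x => dist x (T^[p] x)) (by have := hcont.iterate p; fun_prop)
  refine ⟨x, hx, Function.mk_mem_periodicPts hp.bot_lt ?_⟩
  by_contra hper
  have hpos : 0 < dist x (T^[p] x) := dist_pos.2 fun h => hper h.symm
  -- The point `x` itself is lifted along `T^[p]`: from `T^[p] x' = x` the displacement of `x'` is
  -- `dist x' x`, at most `r ^ p` times the minimal one.
  obtain ⟨x', hx', hTx', hd⟩ := exists_iterate_lift hr0 hr1 hT hδs p x hx x hx
    ((hmin hx₀).trans_lt hclose)
  have h1 : dist x (T^[p] x) ≤ dist x' (T^[p] x') := hmin hx'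
  rw [hTx'] at h1
  have h2 : r ^ p < 1 := pow_lt_one₀ hr0 hr1 hp
  nlinarith

end Lifting

/-! ### The chordal metric -/

/-- The inverse stereographic projection, onto the unit sphere of `ℂ × ℝ`. -/
def stereo (z : Sphere) : WithLp 2 (ℂ × ℝ) :=
  z.elim (WithLp.toLp 2 (0, 1)) fun w =>
    WithLp.toLp 2 (((2 / (1 + ‖w‖ ^ 2) : ℝ) : ℂ) * w, 1 - 2 / (1 + ‖w‖ ^ 2))

/-- The rotation of `ℂ × ℝ` that corresponds to the inversion. -/
def stereoFlip (v : WithLp 2 (ℂ × ℝ)) : WithLp 2 (ℂ × ℝ) := WithLp.toLp 2 (conj v.fst, -v.snd)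

theorem dist_stereoFlip (u v : WithLp 2 (ℂ × ℝ)) :
    dist (stereoFlip u) (stereoFlip v) = dist u v := by
  rw [WithLp.prod_dist_eq_of_L2, WithLp.prod_dist_eq_of_L2]
  simp [stereoFlip, Complex.dist_conj_conj, dist_neg_neg]

theorem stereo_chart_true (w : ℂ) : stereo (chart true w) = stereoFlip (stereo (chart false w)) := by
  by_cases hw : w = 0
  · subst hw
    rw [chart_true_zero, chart_false]
    simp [stereo, stereoFlip]
    norm_num
  · have hn : ‖w‖ ≠ 0 := norm_ne_zero_iff.2 hw
    have hA := one_add_norm_sq_ne_zero w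
    have hA' : ‖w‖ ^ 2 + 1 ≠ 0 := by rwa [add_comm]
    rw [chart_true, inversion_coe hw, chart_false]
    simp only [stereo, OnePoint.elim_some, stereoFlip, WithLp.toLp_fst, WithLp.toLp_snd]
    have h1 : 2 / (1 + ‖w⁻¹‖ ^ 2) = 2 / (1 + ‖w‖ ^ 2) * ‖w‖ ^ 2 := by
      rw [norm_inv]
      field_simp
      ring
    rw [h1]
    congr 2
    · rw [map_mul, Complex.conj_ofReal, Complex.ofReal_mul, mul_assoc, Complex.ofReal_pow,
        ← Complex.conj_mul', mul_assoc, mul_inv_cancel₀ hw, mul_one]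
    · field_simp
      ring

theorem dist_stereo_chart (b : Bool) (z w : ℂ) : dist (stereo (chart b z)) (stereo (chart b w)) =
    2 * ‖z - w‖ / (√(1 + ‖z‖ ^ 2) * √(1 + ‖w‖ ^ 2)) := by
  have h : ∀ b, dist (stereo (chart b z)) (stereo (chart b w)) =
      dist (stereo (chart false z)) (stereo (chart false w)) := by
    rintro (_ | _)
    · rfl
    · rw [stereo_chart_true, stereo_chart_true, dist_stereoFlip]
  rw [h, WithLp.prod_dist_eq_of_L2, ← Real.sqrt_mul (one_add_norm_sq_pos z).le,
    Real.sqrt_eq_iff_eq_sq (by positivity) (by positivity), div_pow,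
    Real.sq_sqrt (by positivity)]
  simp only [stereo, chart_false, OnePoint.elim_some, Complex.dist_eq, Real.dist_eq, sq_abs]
  have hA := one_add_norm_sq_ne_zero z
  have hB := one_add_norm_sq_ne_zero w
  simp only [mul_pow, WithLp.toLp_fst, WithLp.toLp_snd, ← Complex.normSq_eq_norm_sq,
    Complex.normSq_apply, Complex.sub_re, Complex.sub_im, Complex.re_ofReal_mul,
    Complex.im_ofReal_mul] at hA hB ⊢
  field_simp
  ring

theorem continuous_stereo : Continuous stereo := by
  have hc : Continuous fun w : ℂ => stereo (chart false w) := by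
    have : Continuous fun w : ℂ =>
        ((((2 / (1 + ‖w‖ ^ 2) : ℝ) : ℂ) * w, 1 - 2 / (1 + ‖w‖ ^ 2)) : ℂ × ℝ) := by
      have h : Continuous fun w : ℂ => 2 / (1 + ‖w‖ ^ 2) :=
        continuous_const.div (by fun_prop) one_add_norm_sq_ne_zero
      fun_prop
    exact (WithLp.prod_continuous_toLp 2 ℂ ℝ).comp this
  have hflip : Continuous stereoFlip := (Isometry.of_dist_eq dist_stereoFlip).continuous
  rw [continuous_iff_continuousAt]
  intro z
  obtain ⟨b, a, rfl⟩ := exists_chart z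
  rw [ContinuousAt, ← map_chart_nhds, tendsto_map'_iff]
  cases b
  · exact hc.continuousAt
  · have h : stereo ∘ chart true = fun w => stereoFlip (stereo (chart false w)) :=
      funext stereo_chart_true
    rw [stereo_chart_true, h]
    exact (hflip.comp hc).continuousAt

theorem stereo_injective : Function.Injective stereo := by
  have hne : ∀ w : ℂ, stereo (w : Sphere) ≠ stereo OnePoint.infty := by
    intro w h
    have := congrArg WithLp.snd h
    simp [stereo, one_add_norm_sq_ne_zero] at this
  intro z w h
  induction z using OnePoint.rec with
  | infty =>
    induction w using OnePoint.rec with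
    | infty => rfl
    | coe w => exact absurd h.symm (hne w)
  | coe z =>
    induction w using OnePoint.rec with
    | infty => exact absurd h (hne z)
    | coe w =>
      have hd := dist_stereo_chart false z w
      rw [chart_false, chart_false, h, dist_self, eq_comm, div_eq_zero_iff] at hd
      have hpos : √(1 + ‖z‖ ^ 2) * √(1 + ‖w‖ ^ 2) ≠ 0 := by positivity
      simpa [sub_eq_zero, hpos] using hd

theorem isEmbedding_stereo : IsEmbedding stereo :=
  (continuous_stereo.isClosedEmbedding stereo_injective).isEmbedding

/-- The chordal metric of the sphere. -/
abbrev sphereMetric : MetricSpace Sphere := isEmbedding_stereo.comapMetricSpace stereo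

/-- A holomorphic map contracts the chordal metric locally, if the spherical norm of its derivative
is smaller than `1`. -/
theorem eventually_dist_stereo_le {h : ℂ → ℂ} {e : ℂ} {r : ℝ} (hh : AnalyticAt ℂ h e)
    (hr : sphNorm h e < r) (b c : Bool) : ∀ᶠ p : ℂ × ℂ in 𝓝 (e, e),
      dist (stereo (chart b (h p.1))) (stereo (chart b (h p.2))) ≤
        r * dist (stereo (chart c p.1)) (stereo (chart c p.2)) := by
  have hc1 : ContinuousAt (fun p : ℂ × ℂ => h p.1) (e, e) :=
    ContinuousAt.comp (g := h) hh.continuousAt continuousAt_fst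
  have hc2 : ContinuousAt (fun p : ℂ × ℂ => h p.2) (e, e) :=
    ContinuousAt.comp (g := h) hh.continuousAt continuousAt_snd
  obtain ⟨ε, hε, hεr⟩ : ∃ ε > 0, (‖deriv h e‖ + ε) * (1 + ‖e‖ ^ 2) / (1 + ‖h e‖ ^ 2) < r := by
    have ht : Tendsto (fun ε : ℝ => (‖deriv h e‖ + ε) * (1 + ‖e‖ ^ 2) / (1 + ‖h e‖ ^ 2)) (𝓝[>] 0)
        (𝓝 (sphNorm h e)) := by
      have : Continuous fun ε : ℝ => (‖deriv h e‖ + ε) * (1 + ‖e‖ ^ 2) / (1 + ‖h e‖ ^ 2) := by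
        fun_prop
      simpa [sphNorm] using (this.tendsto 0).mono_left nhdsWithin_le_nhds
    obtain ⟨ε, h1, h2⟩ := ((ht.eventually_lt_const hr).and self_mem_nhdsWithin).exists
    exact ⟨ε, h2, h1⟩
  have hstrict : ∀ᶠ p : ℂ × ℂ in 𝓝 (e, e), ‖h p.1 - h p.2‖ ≤ (‖deriv h e‖ + ε) * ‖p.1 - p.2‖ := by
    filter_upwards [hh.hasStrictDerivAt.isLittleO.def hε] with p hp
    calc ‖h p.1 - h p.2‖ = ‖(p.1 - p.2) • deriv h e +
          (h p.1 - h p.2 - (p.1 - p.2) • deriv h e)‖ := by rw [add_sub_cancel]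
      _ ≤ ‖(p.1 - p.2) • deriv h e‖ + ‖h p.1 - h p.2 - (p.1 - p.2) • deriv h e‖ := norm_add_le _ _
      _ ≤ ‖p.1 - p.2‖ * ‖deriv h e‖ + ε * ‖p.1 - p.2‖ := by rw [norm_smul]; gcongr; exact hp
      _ = _ := by ring
  -- The chordal distance is the Euclidean one divided by square-root weights; on the diagonal at
  -- `e` this quotient is the expression bounded in `hεr`.
  have hweight : ∀ᶠ p : ℂ × ℂ in 𝓝 (e, e),
      (‖deriv h e‖ + ε) * (√(1 + ‖p.1‖ ^ 2) * √(1 + ‖p.2‖ ^ 2)) /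
        (√(1 + ‖h p.1‖ ^ 2) * √(1 + ‖h p.2‖ ^ 2)) < r := by
    refine ContinuousAt.eventually_lt (ContinuousAt.div (by fun_prop) (by fun_prop) ?_)
      continuousAt_const ?_
    · positivity
    · simpa only [Real.mul_self_sqrt (one_add_norm_sq_pos _).le] using hεr
  filter_upwards [hstrict, hweight] with p h1 h2
  rw [dist_stereo_chart, dist_stereo_chart]
  have hA : 0 < √(1 + ‖p.1‖ ^ 2) * √(1 + ‖p.2‖ ^ 2) := by positivity
  have hB : 0 < √(1 + ‖h p.1‖ ^ 2) * √(1 + ‖h p.2‖ ^ 2) := by positivity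
  rw [div_lt_iff₀ hB] at h2
  rw [mul_div_assoc', div_le_div_iff₀ hB hA]
  have hn := norm_nonneg (p.1 - p.2)
  calc _ ≤ 2 * ((‖deriv h e‖ + ε) * ‖p.1 - p.2‖) * (√(1 + ‖p.1‖ ^ 2) * √(1 + ‖p.2‖ ^ 2)) := by
        gcongr
    _ = 2 * ‖p.1 - p.2‖ * ((‖deriv h e‖ + ε) * (√(1 + ‖p.1‖ ^ 2) * √(1 + ‖p.2‖ ^ 2))) := by ring
    _ ≤ 2 * ‖p.1 - p.2‖ * (r * (√(1 + ‖h p.1‖ ^ 2) * √(1 + ‖h p.2‖ ^ 2))) := by gcongr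
    _ = _ := by ring

/-! ### Orbits of maximal expansion -/

/-- The set of the points whose whole orbit consists of points of maximal expansion. -/
def maxOrbitSet (F : Sphere → Sphere) : Set Sphere := {z | ∀ j : ℕ, F^[j] z ∈ maxSet F}

theorem mem_maxOrbitSet_iff {F : Sphere → Sphere} {z : Sphere} :
    z ∈ maxOrbitSet F ↔ z ∈ maxSet F ∧ F z ∈ maxOrbitSet F :=
  ⟨fun h => ⟨h 0, fun j => h (j + 1)⟩, fun h j => by
    cases j with
    | zero => exact h.1
    | succ j => exact h.2 j⟩

theorem accPt_chart_iff {b : Bool} {a : ℂ} {s : Set Sphere} :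
    AccPt (chart b a) (𝓟 s) ↔ ∃ᶠ w in 𝓝[≠] a, chart b w ∈ s := by
  rw [accPt_iff_frequently, frequently_nhdsWithin_iff, ← map_chart_nhds, frequently_map]
  simp only [(chart_injective b).ne_iff, Set.mem_compl_iff, Set.mem_singleton_iff, ne_eq, and_comm]

theorem map_chart_prod_nhds (b c : Bool) (a e : ℂ) :
    map (Prod.map (chart b) (chart c)) (𝓝 (a, e)) = 𝓝 (chart b a, chart c e) := by
  rw [nhds_prod_eq, nhds_prod_eq, ← map_chart_nhds, ← map_chart_nhds, Filter.prod_map_map_eq']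

variable {F : Sphere → Sphere}

theorem isClosed_maxOrbitSet (H : Hol F) : IsClosed (maxOrbitSet F) := by
  simp only [maxOrbitSet, Set.ofPred_forall]
  exact isClosed_iInter fun j => H.isClosed_maxSet.preimage (H.iterate j).continuous

theorem deriv_ne_zero_of_mem_maxSet (hK : 1 < supDeriv F) {b c : Bool} {g : ℂ → ℂ} {a : ℂ}
    (hg : HasRep F b c g a) (hz : chart b a ∈ maxSet F) : deriv g a ≠ 0 := by
  intro h
  have h1 : sphDeriv F (chart b a) = supDeriv F := hz
  rw [hg.sphDeriv_eq, sphNorm_eq_zero_iff.2 h] at h1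
  linarith

theorem derivedSet_maxOrbitSet_subset (H : Hol F) :
    derivedSet (maxOrbitSet F) ⊆ maxOrbitSet F :=
  isClosed_iff_derivedSet_subset _ |>.1 (isClosed_maxOrbitSet H)

/-- The derivative does not vanish on `maxSet F`, so `F` takes punctured neighbourhoods to punctured
neighbourhoods and preserves accumulation. -/
theorem mapsTo_derivedSet_maxOrbitSet (H : Hol F) (hK : 1 < supDeriv F) :
    Set.MapsTo F (derivedSet (maxOrbitSet F)) (derivedSet (maxOrbitSet F)) := by
  intro z hz
  obtain ⟨b, c, g, a, rfl, hg⟩ := H z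
  have hg' := deriv_ne_zero_of_mem_maxSet hK hg (derivedSet_maxOrbitSet_subset H hz 0)
  rw [hg.apply]
  rw [mem_derivedSet, accPt_chart_iff] at hz ⊢
  refine (hg.analyticAt.differentiableAt.hasDerivAt.tendsto_nhdsNE hg').frequently ?_
  refine (hz.and_eventually (hg.eventually_eq.filter_mono nhdsWithin_le_nhds)).mono ?_
  rintro w ⟨hw1, hw2⟩
  rw [← hw2]
  exact (mem_maxOrbitSet_iff.1 hw1).2

/-- Near an accumulation point of orbits of maximal expansion, the local inverse of the map
preserves such orbits. -/
theorem exists_local_inverse (H : Hol F) (hK : 1 < supDeriv F) {b c : Bool} {g : ℂ → ℂ} {a : ℂ}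
    (hg : HasRep F b c g a) (hz : chart b a ∈ derivedSet (maxOrbitSet F)) :
    ∃ h : ℂ → ℂ, AnalyticAt ℂ h (g a) ∧ sphNorm h (g a) = (supDeriv F)⁻¹ ∧
      (∀ᶠ w in 𝓝 a, h (g w) = w) ∧
      ∀ᶠ y in 𝓝 (g a), F (chart b (h y)) = chart c y ∧
        (chart c y ∈ derivedSet (maxOrbitSet F) → chart b (h y) ∈ derivedSet (maxOrbitSet F)) := by
  have hzE := derivedSet_maxOrbitSet_subset H hz
  have hg' := deriv_ne_zero_of_mem_maxSet hK hg (hzE 0)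
  have hgs := hg.analyticAt.hasStrictDerivAt
  set h := hgs.localInverse _ _ _ hg' with hh
  have hhan : AnalyticAt ℂ h (g a) := hg.analyticAt.analyticAt_localInverse hg'
  have hleft : ∀ᶠ w in 𝓝 a, h (g w) = w :=
    HasStrictFDerivAt.eventually_left_inverse _
  have hright : ∀ᶠ y in 𝓝 (g a), g (h y) = y :=
    HasStrictFDerivAt.eventually_right_inverse _
  have hha : h (g a) = a := hleft.self_of_nhds
  have hht : Tendsto h (𝓝 (g a)) (𝓝 a) := by
    simpa only [hha] using hhan.continuousAt.tendsto
  have hrep : ∀ᶠ y in 𝓝 (g a), HasRep F b c g (h y) := hht.eventually hg.eventually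
  have hmul : ∀ᶠ y in 𝓝 (g a), sphNorm g (h y) * sphNorm h y = 1 := by
    filter_upwards [hrep, hhan.eventually_analyticAt, hright.eventually_nhds] with y h1 h2 h3
    rw [← sphNorm_comp h1.analyticAt.differentiableAt h2.differentiableAt, ← sphNorm_id y]
    exact sphNorm_congr h3
  have hK0 : supDeriv F ≠ 0 := by linarith
  have hga : sphNorm h (g a) = (supDeriv F)⁻¹ := by
    have h1 := hmul.self_of_nhds
    rw [hha, ← hg.sphDeriv_eq, show sphDeriv F (chart b a) = supDeriv F from hzE 0] at h1
    exact eq_inv_of_mul_eq_one_right h1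
  -- the points of maximal expansion near the image point
  obtain ⟨d, e, hde⟩ := exists_chart (F (chart c (g a)))
  obtain ⟨g₂, hg₂, -⟩ := (H (chart c (g a))).exists_rep rfl hde
  have hmax0 : sphNorm g₂ (g a) = supDeriv F := by
    rw [← hg₂.sphDeriv_eq, ← hg.apply]
    exact hzE 1
  -- The equality for `h` is known at the images of the points of `maxOrbitSet F` accumulating at
  -- `chart b a`. These images are points of maximal expansion accumulating at the image point, so
  -- the equality spreads to all points of maximal expansion nearby.
  have hE : ∀ᶠ y in 𝓝 (g a), sphNorm g₂ y = supDeriv F → sphNorm h y = (supDeriv F)⁻¹ := by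
    rw [← hmax0]
    refine sphNorm_eq_of_frequently hg₂.analyticAt hhan ?_ (by rwa [hmax0]) ?_ ?_
    · filter_upwards [hg₂.eventually] with y hy
      rw [hmax0, ← hy.sphDeriv_eq]
      exact H.sphDeriv_le _
    · exact inv_nonneg.2 (sphNorm_nonneg _ _)
    · refine (hg.analyticAt.differentiableAt.hasDerivAt.tendsto_nhdsNE hg').frequently ?_
      rw [mem_derivedSet, accPt_chart_iff] at hz
      have hgt := hg.analyticAt.continuousAt.tendsto
      have hev := (hg.eventually.and (hleft.and ((hgt.eventually hg₂.eventually).and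
        (hgt.eventually hmul)))).filter_mono (nhdsWithin_le_nhds (s := {a}ᶜ))
      refine (hz.and_eventually hev).mono ?_
      rintro w ⟨hwE, hw1, hw2, hw3, hw4⟩
      rw [hmax0]
      constructor
      · rw [← hw3.sphDeriv_eq, ← hw1.apply]
        exact hwE 1
      · rw [hw2, ← hw1.sphDeriv_eq, show sphDeriv F (chart b w) = supDeriv F from hwE 0] at hw4
        exact eq_inv_of_mul_eq_one_right hw4
  have happ : ∀ᶠ y in 𝓝 (g a), F (chart b (h y)) = chart c y := by
    filter_upwards [hrep, hright] with y h1 h2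
    rw [h1.apply, h2]
  have hEmem : ∀ᶠ y in 𝓝 (g a), chart c y ∈ maxOrbitSet F → chart b (h y) ∈ maxOrbitSet F := by
    filter_upwards [hE, happ, hg₂.eventually, hrep, hmul] with y h1 h2 h3 h4 h5 hy
    rw [mem_maxOrbitSet_iff, h2]
    refine ⟨?_, hy⟩
    have h6 := h1 (by rw [← h3.sphDeriv_eq]; exact hy 0)
    rw [h6, mul_inv_eq_one₀ hK0] at h5
    exact h4.sphDeriv_eq.trans h5
  -- Nonvanishing of `deriv h` lets `h` carry accumulation points to accumulation points, which
  -- passes from `maxOrbitSet F` to its derived set.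
  have hh' : ∀ᶠ y in 𝓝 (g a), deriv h y ≠ 0 := by
    refine hhan.deriv.continuousAt.eventually_ne ?_
    rw [Ne, ← sphNorm_eq_zero_iff, hga]
    exact inv_ne_zero hK0
  refine ⟨h, hhan, hga, hleft, ?_⟩
  filter_upwards [happ, hEmem.eventually_nhds, hh', hhan.eventually_analyticAt] with y h1 h2 h3 h4
  refine ⟨h1, fun hy => ?_⟩
  rw [mem_derivedSet, accPt_chart_iff] at hy ⊢
  refine (h4.differentiableAt.hasDerivAt.tendsto_nhdsNE h3).frequently ?_
  exact (hy.and_eventually (h2.filter_mono nhdsWithin_le_nhds)).mono fun w hw => hw.2 hw.1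

/-- If the set of the points whose orbits consist of points of maximal expansion is infinite, then
it contains a periodic point. -/
theorem exists_mem_periodicPts_of_infinite (H : Hol F) (hK : 1 < supDeriv F)
    (hinf : (maxOrbitSet F).Infinite) : ∃ z ∈ maxOrbitSet F, z ∈ Function.periodicPts F := by
  let _ : MetricSpace Sphere := sphereMetric
  -- A local inverse whose norm at the point is `(supDeriv F)⁻¹` contracts nearby chordal distances
  -- by any larger factor `r`.
  obtain ⟨r, hr1, hr2⟩ := exists_between (inv_lt_one_of_one_lt₀ hK)
  have hr0 : 0 ≤ r := (inv_nonneg.2 H.supDeriv_nonneg).trans hr1.le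
  have hlift : ∀ z ∈ derivedSet (maxOrbitSet F), ∀ᶠ p in 𝓝 (z, F z),
      p.1 ∈ derivedSet (maxOrbitSet F) → p.2 ∈ derivedSet (maxOrbitSet F) →
      ∃ x' ∈ derivedSet (maxOrbitSet F), F x' = p.2 ∧ dist x' p.1 ≤ r * dist p.2 (F p.1) := by
    intro z hz
    obtain ⟨b, c, g, a, rfl, hg⟩ := H z
    obtain ⟨h, hhan, hnorm, hleft, hinv⟩ := exists_local_inverse H hK hg hz
    rw [hg.apply, ← map_chart_prod_nhds, eventually_map]
    have t1 : Tendsto (fun q : ℂ × ℂ => q.1) (𝓝 (a, g a)) (𝓝 a) := continuousAt_fst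
    have t2 : Tendsto (fun q : ℂ × ℂ => q.2) (𝓝 (a, g a)) (𝓝 (g a)) := continuousAt_snd
    have t3 : Tendsto (fun q : ℂ × ℂ => (q.2, g q.1)) (𝓝 (a, g a)) (𝓝 (g a, g a)) :=
      t2.prodMk_nhds (hg.analyticAt.continuousAt.tendsto.comp t1)
    filter_upwards [t1.eventually hleft, t1.eventually hg.eventually_eq, t2.eventually hinv,
      t3.eventually (eventually_dist_stereo_le hhan (hnorm.trans_lt hr1) b c)]
      with q h1 h2 h3 h4 _ hq
    refine ⟨chart b (h q.2), h3.2 hq, h3.1, ?_⟩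
    rw [h1] at h4
    simp only [Prod.map_fst, Prod.map_snd]
    rw [h2]
    exact h4
  obtain ⟨z, hz, hper⟩ := exists_mem_periodicPts_of_lift
    (isClosed_derivedSet (maxOrbitSet F)).isCompact hinf.exists_accPt_principal H.continuous
    (mapsTo_derivedSet_maxOrbitSet H hK) hr0 hr2 hlift
  exact ⟨z, derivedSet_maxOrbitSet_subset H hz, hper⟩

theorem exists_mem_periodicPts_of_finite {α : Type*} {T : α → α} {s : Set α} (hs : s.Finite)
    (hne : s.Nonempty) (hT : Set.MapsTo T s s) : ∃ z ∈ s, z ∈ Function.periodicPts T := by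
  obtain ⟨z, hz⟩ := hne
  obtain ⟨m, n, hmn, h⟩ := hs.exists_lt_map_eq_of_forall_mem (f := fun n => T^[n] z)
    fun n => hT.iterate n hz
  refine ⟨T^[m] z, hT.iterate m hz, Function.mk_mem_periodicPts (Nat.sub_pos_of_lt hmn) ?_⟩
  rw [Function.IsPeriodicPt, Function.IsFixedPt, ← Function.iterate_add_apply,
    Nat.sub_add_cancel hmn.le]
  exact h.symm

theorem exists_mem_periodicPts_of_nonempty (H : Hol F) (hK : 1 < supDeriv F)
    (hne : (maxOrbitSet F).Nonempty) : ∃ z ∈ maxOrbitSet F, z ∈ Function.periodicPts F := by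
  rcases (maxOrbitSet F).finite_or_infinite with hfin | hinf
  · exact exists_mem_periodicPts_of_finite hfin hne fun z hz => (mem_maxOrbitSet_iff.1 hz).2
  · exact exists_mem_periodicPts_of_infinite H hK hinf

/-! ### The growth rate of the maximal expansion -/

theorem supDeriv_iterate_le_pow (H : Hol F) (n : ℕ) : supDeriv F^[n] ≤ supDeriv F ^ n := by
  obtain ⟨z, hz⟩ := (H.iterate n).exists_sphDeriv_eq
  rw [← hz, H.sphDeriv_iterate]
  calc _ ≤ ∏ _i ∈ Finset.range n, supDeriv F :=
        Finset.prod_le_prod (fun i _ => (H _).sphDeriv_nonneg) fun i _ => H.sphDeriv_le _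
    _ = _ := by simp

theorem supDeriv_iterate_eq_pow (H : Hol F) {z : Sphere} (hz : z ∈ maxOrbitSet F) (n : ℕ) :
    supDeriv F^[n] = supDeriv F ^ n := by
  refine le_antisymm (supDeriv_iterate_le_pow H n) ?_
  refine le_trans (le_of_eq ?_) ((H.iterate n).sphDeriv_le z)
  rw [H.sphDeriv_iterate, Finset.prod_congr rfl fun i _ => (hz i : sphDeriv F (F^[i] z) = _)]
  simp

/-- If the maximal expansion is multiplicative along the iterates, then there is an orbit of
maximal expansion. -/
theorem nonempty_maxOrbitSet (H : Hol F) (hK : 1 < supDeriv F)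
    (hpow : ∀ n, supDeriv F ^ n ≤ supDeriv F^[n]) : (maxOrbitSet F).Nonempty := by
  -- The sets `C n` are compact and decreasing. They are nonempty because at a point of maximal
  -- expansion of `F^[n]` a product of `n` factors, each at most `supDeriv F`, is at least `supDeriv
  -- F ^ n`; so no factor is smaller.
  set C : ℕ → Set Sphere := fun n => {z | ∀ i < n, F^[i] z ∈ maxSet F} with hC
  have hclosed : ∀ n, IsClosed (C n) := fun n => by
    simp only [hC, Set.ofPred_forall]
    exact isClosed_iInter fun i => isClosed_iInter fun _ =>
      H.isClosed_maxSet.preimage (H.iterate i).continuous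
  have hne : ∀ n, (C n).Nonempty := fun n => by
    obtain ⟨z, hz⟩ := (H.iterate n).exists_sphDeriv_eq
    refine ⟨z, fun i hi => ?_⟩
    by_contra hcon
    have hlt : sphDeriv F (F^[i] z) < supDeriv F := lt_of_le_of_ne (H.sphDeriv_le _) hcon
    have hpos : 0 < supDeriv F := by linarith
    have h1 : ∏ i ∈ Finset.range n, sphDeriv F (F^[i] z) < supDeriv F ^ n := by
      rw [← Finset.mul_prod_erase _ _ (Finset.mem_range.2 hi)]
      have h2 : ∏ j ∈ (Finset.range n).erase i, sphDeriv F (F^[j] z) ≤ supDeriv F ^ (n - 1) := by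
        calc _ ≤ ∏ _j ∈ (Finset.range n).erase i, supDeriv F :=
              Finset.prod_le_prod (fun i _ => (H _).sphDeriv_nonneg) fun i _ => H.sphDeriv_le _
          _ = _ := by simp [Finset.card_erase_of_mem (Finset.mem_range.2 hi)]
      calc _ ≤ sphDeriv F (F^[i] z) * supDeriv F ^ (n - 1) :=
            mul_le_mul_of_nonneg_left h2 (H _).sphDeriv_nonneg
        _ < supDeriv F * supDeriv F ^ (n - 1) := by gcongr
        _ = _ := by rw [← pow_succ', Nat.sub_add_cancel (by omega)]
    rw [← H.sphDeriv_iterate, hz] at h1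
    exact absurd (hpow n) (not_le.2 h1)
  obtain ⟨z, hz⟩ := IsCompact.nonempty_iInter_of_sequence_nonempty_isCompact_isClosed C
    (fun n z hz i hi => hz i (by omega)) hne (hclosed 0).isCompact hclosed
  exact ⟨z, fun j => Set.mem_iInter.1 hz (j + 1) j j.lt_succ_self⟩

theorem subadditive_log_supDeriv (H : Hol F) (hpos : ∀ n, 1 ≤ supDeriv F^[n]) :
    Subadditive fun n => Real.log (supDeriv F^[n]) := by
  intro m n
  have h0 : ∀ n, 0 < supDeriv F^[n] := fun n => zero_lt_one.trans_le (hpos n)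
  rw [← Real.log_mul (h0 m).ne' (h0 n).ne']
  refine Real.log_le_log (h0 _) ?_
  rw [Function.iterate_add]
  exact (H.iterate m).supDeriv_comp_le (H.iterate n)

theorem bddBelow_log_supDeriv (hpos : ∀ n, 1 ≤ supDeriv F^[n]) :
    BddBelow (Set.range fun n : ℕ => Real.log (supDeriv F^[n]) / n) :=
  ⟨0, by
    rintro _ ⟨n, rfl⟩
    exact div_nonneg (Real.log_nonneg (hpos n)) n.cast_nonneg⟩

theorem one_le_supDeriv_iterate {f : RatFunc ℂ} (hf : 2 ≤ ratDegree f) (n : ℕ) :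
    1 ≤ supDeriv (toSphereMap f)^[n] := by
  rcases eq_or_ne n 0 with rfl | hn
  · obtain ⟨z, hz⟩ := (((hol_toSphereMap f).iterate 0)).exists_sphDeriv_eq
    rw [← hz]
    exact (sphDeriv_id z).ge
  · exact (one_lt_supDeriv_iterate hf hn).le

end SphericalDynamics

end

/-! ### The main theorem -/

open SphericalDynamics

theorem mainTheorem6 (f : RatFunc ℂ) (hf : 2 ≤ SphericalDynamics.ratDegree f) :
    (∀ n : ℕ, IsGreatest
      (Set.range (SphericalDynamics.sphDeriv (SphericalDynamics.toSphereMap f)^[n]))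
      (SphericalDynamics.supDeriv (SphericalDynamics.toSphereMap f)^[n])) ∧
    Tendsto
      (fun n : ℕ => 1 / (n : ℝ) *
        Real.log (SphericalDynamics.supDeriv (SphericalDynamics.toSphereMap f)^[n]))
      atTop (𝓝 (SphericalDynamics.kInfty (SphericalDynamics.toSphereMap f))) ∧
    (SphericalDynamics.kInfty (SphericalDynamics.toSphereMap f) =
        Real.log (SphericalDynamics.supDeriv (SphericalDynamics.toSphereMap f)) ↔
      ∃ z ∈ Function.periodicPts (SphericalDynamics.toSphereMap f),
        ∀ j : ℕ, (SphericalDynamics.toSphereMap f)^[j] z ∈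
          SphericalDynamics.maxSet (SphericalDynamics.toSphereMap f)) := by
  have H := hol_toSphereMap f
  have hK := one_lt_supDeriv_toSphereMap hf
  have hpos := one_le_supDeriv_iterate hf
  set F := toSphereMap f
  have hsub := subadditive_log_supDeriv H hpos
  have hbdd := bddBelow_log_supDeriv hpos
  have hlim : Tendsto (fun n : ℕ => 1 / (n : ℝ) * Real.log (supDeriv F^[n])) atTop
      (𝓝 hsub.lim) := by
    simpa only [one_div, inv_mul_eq_div] using hsub.tendsto_lim hbdd
  have hk : kInfty F = hsub.lim := hlim.limUnder_eq
  refine ⟨fun n => (H.iterate n).isGreatest_supDeriv, by rwa [hk], fun h => ?_, ?_⟩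
  -- The Fekete limit is a lower bound of all quotients with `n ≠ 0`, so equality with `log
  -- (supDeriv F)` bounds every iterate from below.
  · have hpow : ∀ n, supDeriv F ^ n ≤ supDeriv F^[n] := by
      intro n
      rcases eq_or_ne n 0 with rfl | hn
      · simpa using hpos 0
      have h1 := hsub.lim_le_div hbdd hn
      rw [← hk, h, le_div_iff₀ (by positivity), mul_comm, ← Real.log_pow] at h1
      exact (Real.log_le_log_iff (by positivity) (zero_lt_one.trans_le (hpos n))).1 h1
    obtain ⟨z, hz, hper⟩ :=
      exists_mem_periodicPts_of_nonempty H hK (nonempty_maxOrbitSet H hK hpow)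
    exact ⟨z, hper, hz⟩
  · rintro ⟨z, -, hz⟩
    -- Along an orbit of maximal expansion the sequence is constantly `log (supDeriv F)` for `n ≠
    -- 0`; at `n = 0` the convention `1 / 0 = 0` makes its term `0`.
    refine tendsto_nhds_unique (hk ▸ hlim) (tendsto_const_nhds.congr' ?_)
    filter_upwards [eventually_ne_atTop 0] with n hn
    have hn' : (n : ℝ) ≠ 0 := Nat.cast_ne_zero.2 hn
    rw [supDeriv_iterate_eq_pow H hz, Real.log_pow]
    field_simp
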